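/- Proposition ($C^0H^s$ Duhamel estimate). For $t\ge 0$ let $S(t)=e^{-\frac{\sqrt{-\Delta}}{2}t}\,\frac{\sin\left(\frac{\sqrt3}{2}\sqrt{-\Delta}\,t\right)}{\frac{\sqrt3}{2}\sqrt{-\Delta}}$ be the Fourier multiplier on $\mathbb R^n$ with $\widehat{S(t)f}(\xi)=e^{-\frac{|\xi|}{2}t}\,\frac{\sin\left(\frac{\sqrt3}{2}|\xi|t\right)}{\frac{\sqrt3}{2}|\xi|}\,\widehat f(\xi)$ (with $\widehat f(\xi)=\int e^{-ix\cdot\xi}f(x)\,dx$), and let $H^s(\mathbb R^n)$ be the inhomogeneous Sobolev space of tempered distributions $f$ with $(1+|\xi|^2)^{s/2}\widehat f\in L^2$, with its usual norm. Let $n=2$, and let $2\le\tilde q\le\infty$, $2\le\tilde r<\infty$ and $s\ge 0$ satisfy the gap condition $$\frac n2-s=\frac1{\tilde q'}+\frac n{\tilde r'}-2,$$ where $\tilde q'$, $\tilde r'$ are the Hölder conjugates of $\tilde q$, $\tilde r$. Then there is a constant $C>0$, depending only on $\tilde q$ and $\tilde r$, such that for every $0<T\le 1$ and every $F\in L^{\tilde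 q'}([0,T];L^{\tilde r'}(\mathbb R^2))$ the function $$u(t)=\int_0^t S(t-\tau)F(\tau,\cdot)\,d\tau,\qquad 0\le t\le T$$ (an absolutely convergent integral of tempered distributions, i.e. tested against Schwartz functions), belongs to $C^0([0,T];H^s(\mathbb R^2))$ and satisfies $$\|u\|_{C^0([0,T];H^s(\mathbb R^2))}\le C\,\|F\|_{L^{\tilde q'}_t([0,T];L^{\tilde r'}_x(\mathbb R^2))}.$$ -/

import Mathlib

open MeasureTheory TemperedDistribution
open scoped ENNReal FourierTransform SchwartzMap

/-- The Euclidean plane. -/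
abbrev Plane : Type := EuclideanSpace ℝ (Fin 2)

noncomputable section

/-! ### The Sobolev space `H^s` of the plane as a normed space

Its elements are the tempered distributions `f` with `(1 + ‖ξ‖ ^ 2) ^ (s / 2) 𝓕 f ∈ L²`, and the
norm is the `L²` norm of `𝓕⁻ ((1 + ‖ξ‖ ^ 2) ^ (s / 2) 𝓕 f)`, which equals that of
`(1 + ‖ξ‖ ^ 2) ^ (s / 2) 𝓕 f`. The Fourier transform is normalised with `exp (-2 π i ⟨x, ξ⟩)`; any
other normalisation gives the same space with an equivalent norm. -/

/-- The subspace of tempered distributions of Sobolev class `H^s`. -/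
def sobolevSubmodule (s : ℝ) : Submodule ℂ 𝓢'(Plane, ℂ) where
  carrier := {f | MemSobolev s 2 f}
  add_mem' := fun hf hg => hf.add hg
  zero_mem' := memSobolev_fun_zero Plane ℂ s 2
  smul_mem' := fun c _ hf => hf.smul c

/-- The Sobolev space `H^s(ℝ²)`. It is a type of its own, so that it carries the topology of its norm
and not that of the space of tempered distributions. -/
def SobolevH (s : ℝ) : Type := sobolevSubmodule s

namespace SobolevH

variable {s : ℝ}

instance instAddCommGroup : AddCommGroup (SobolevH s) :=
  inferInstanceAs (AddCommGroup (sobolevSubmodule s))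

instance instModule : Module ℂ (SobolevH s) :=
  inferInstanceAs (Module ℂ (sobolevSubmodule s))

/-- The tempered distribution underlying an element of `H^s`. -/
def toDistribution (s : ℝ) : SobolevH s →ₗ[ℂ] 𝓢'(Plane, ℂ) := (sobolevSubmodule s).subtype

theorem toDistribution_injective : Function.Injective (toDistribution s) :=
  Subtype.val_injective

theorem memSobolev (f : SobolevH s) : MemSobolev s 2 (toDistribution s f) := f.2

theorem lp_ext {f g : Lp ℂ 2 (volume : Measure Plane)} (h : (f : 𝓢'(Plane, ℂ)) = g) : f = g :=
  LinearMap.ker_eq_bot.mp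
    (Lp.ker_toTemperedDistributionCLM_eq_bot (F := ℂ) (μ := (volume : Measure Plane)) (p := 2)) h

/-- The `L²` function `𝓕⁻ ((1 + ‖ξ‖ ^ 2) ^ (s / 2) 𝓕 f)` of an element `f` of `H^s`. -/
def toL2 (f : SobolevH s) : Lp ℂ 2 (volume : Measure Plane) := Classical.choose f.memSobolev

theorem toL2_spec (f : SobolevH s) :
    besselPotential Plane ℂ s (toDistribution s f) = (toL2 f : 𝓢'(Plane, ℂ)) :=
  Classical.choose_spec f.memSobolev

/-- `toL2` as an additive map. -/
def toL2Hom (s : ℝ) : SobolevH s →+ Lp ℂ 2 (volume : Measure Plane) :=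
  AddMonoidHom.mk' toL2 fun f g => by
    apply lp_ext
    rw [← toL2_spec, map_add, map_add, toL2_spec, toL2_spec]
    exact (map_add (Lp.toTemperedDistributionCLM ℂ (volume : Measure Plane) 2) _ _).symm

theorem toL2Hom_injective : Function.Injective (toL2Hom s) := by
  intro f g h
  have h' : toL2 f = toL2 g := h
  apply toDistribution_injective
  have e : besselPotential Plane ℂ s (toDistribution s f) =
      besselPotential Plane ℂ s (toDistribution s g) := by
    rw [toL2_spec, toL2_spec, h']
  rw [← besselPotential_neg_apply_eq_iff] at e
  simpa using e.symm

instance instNormedAddCommGroup : NormedAddCommGroup (SobolevH s) :=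
  NormedAddCommGroup.induced (SobolevH s) (Lp ℂ 2 (volume : Measure Plane)) (toL2Hom s)
    toL2Hom_injective

theorem norm_eq (f : SobolevH s) : ‖f‖ = ‖toL2 f‖ := rfl

end SobolevH

/-! ### The viscous Duhamel integral -/

/-- The symbol of `exp (-(√(-Δ) / 2) t) sin ((√3 / 2) √(-Δ) t) / ((√3 / 2) √(-Δ))`. With the
normalisation of the Fourier transform by `exp (-2 π i ⟨x, ξ⟩)`, the operator `√(-Δ)` has the symbol
`2 π ‖ξ‖`. The quotient is written with `sinc`, which gives it its limit `t` at `ξ = 0`. -/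
def viscousSymbol (t : ℝ) (ξ : Plane) : ℝ :=
  Real.exp (-(2 * Real.pi * ‖ξ‖) / 2 * t) *
    (t * Real.sinc (Real.sqrt 3 / 2 * (2 * Real.pi * ‖ξ‖) * t))

theorem viscousSymbol_eq (t : ℝ) {ξ : Plane} (hξ : ξ ≠ 0) :
    viscousSymbol t ξ = Real.exp (-(2 * Real.pi * ‖ξ‖) / 2 * t) *
      (Real.sin (Real.sqrt 3 / 2 * (2 * Real.pi * ‖ξ‖) * t) /
        (Real.sqrt 3 / 2 * (2 * Real.pi * ‖ξ‖))) := by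
  have h : Real.sqrt 3 / 2 * (2 * Real.pi * ‖ξ‖) ≠ 0 := by
    have := norm_pos_iff.mpr hξ
    positivity
  unfold viscousSymbol
  congr 1
  rcases eq_or_ne t 0 with rfl | ht
  · simp
  · rw [Real.sinc_of_ne_zero (mul_ne_zero h ht)]
    field_simp

/-- The transpose `𝓕 (m_t 𝓕⁻ φ)` of the Fourier multiplier with symbol `m_t = viscousSymbol t`,
applied to a Schwartz function `φ`. The Fourier multiplier itself acts on a function `f` by
`⟨m_t(D) f, φ⟩ = ∫ 𝓕 (m_t 𝓕⁻ φ) f`. (`m_t` is not smooth at the origin, so that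
`TemperedDistribution.fourierMultiplierCLM` does not apply to it.) -/
def viscousTest (t : ℝ) (φ : 𝓢(Plane, ℂ)) : Plane → ℂ :=
  𝓕 (fun ξ : Plane => (viscousSymbol t ξ : ℂ) * (𝓕⁻ φ : 𝓢(Plane, ℂ)) ξ)

/-- `v` is the Duhamel integral `∫_0^t m_{t - τ}(D) F(τ) dτ`, an integral of tempered
distributions. -/
structure IsViscousDuhamel {p : ℝ≥0∞} (F : ℝ → Lp ℂ p (volume : Measure Plane)) (t : ℝ)
    (v : 𝓢'(Plane, ℂ)) : Prop where
  /-- each `m_{t - τ}(D) F(τ)` is defined by absolutely convergent integrals -/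
  integrable : ∀ φ : 𝓢(Plane, ℂ), ∀ τ ∈ Set.Ioo 0 t,
    Integrable (fun x => viscousTest (t - τ) φ x * F τ x)
  /-- the integral in time converges absolutely -/
  intervalIntegrable : ∀ φ : 𝓢(Plane, ℂ),
    IntervalIntegrable (fun τ => ∫ x, viscousTest (t - τ) φ x * F τ x) volume 0 t
  /-- the value of the integral at a test function -/
  eq_integral : ∀ φ : 𝓢(Plane, ℂ), v φ = ∫ τ in (0 : ℝ)..t, ∫ x, viscousTest (t - τ) φ x * F τ x

end

/-! The estimate is proved by duality and uses only the damping of the symbol,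
$|m_\sigma(\xi)|\le\sigma e^{-\pi\sigma|\xi|}$. The gap condition says $s=1/q+2/r$, so after the
substitution $\sigma=t-\tau$ it suffices to bound $m_\sigma(D)(1-\Delta)^{s/2}\varphi$ in
$L^q((0,1];L^r)$ by $\|\varphi\|_{L^2}$ (`exists_eLpNorm_viscousTestLp_le`).

At fixed $\sigma$, interpolation gives $\|\mathcal F a\|_r\le\|a\|_2^{2/r}\|a\|_1^{1-2/r}$. Part of
the damping absorbs the $2/r$ derivatives, and Cauchy–Schwarz against $e^{-\sigma|\xi|/2}$ turns the
$L^1$ norm into an $L^2$ norm. All powers of $\sigma$ cancel, leaving $W(\sigma)^{1/2}$ with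
$W(\sigma)=\int e^{-\pi\sigma|\xi|}(1+|\xi|)^{2/q}|\psi|^2$, $\psi=\mathcal F^{-1}\varphi$
(`eLpNorm_viscousTest_le`).

In time, the pointwise bound $W\le\sigma^{-2/q}\|\psi\|_2^2$ reduces $\int W^{q/2}d\sigma$ to
$\int\sigma^{2/q-1}W\,d\sigma$, which Tonelli and a Gamma integral control
(`lintegral_dampedEnergy_rpow_le`).

Density and the Riesz theorem then give one bounded operator $\Phi$ on $L^{q'}L^{r'}$
(`exists_duhamel_operator`), applied to the reflected translate of $1_{[0,T]}F$. Continuity of $u$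
is continuity of translations in $L^{q'}$, $q'<\infty$. -/

/-! ### Fourier integrals on $L^1\cap L^2$ -/

theorem integral_fourier_smul_eq {a b : Plane → ℂ} (ha : Integrable a) (hb : Integrable b) :
    ∫ x, 𝓕 a x * b x = ∫ x, a x * 𝓕 b x := by
  have := VectorFourier.integral_fourierIntegral_smul_eq_flip (L := innerₗ Plane)
    Real.continuous_fourierChar continuous_inner ha hb
  simp only [flip_innerₗ, smul_eq_mul] at this
  exact this

theorem norm_fourier_le_integral (a : Plane → ℂ) (ξ : Plane) : ‖𝓕 a ξ‖ ≤ ∫ x, ‖a x‖ :=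
  VectorFourier.norm_fourierIntegral_le_integral_norm _ _ _ _ _

theorem continuous_fourier {a : Plane → ℂ} (ha : Integrable a) : Continuous (𝓕 a) :=
  VectorFourier.fourierIntegral_continuous Real.continuous_fourierChar
      continuous_inner ha

theorem ae_eq_of_integral_schwartz_eq {f g : Plane → ℂ} (hf : LocallyIntegrable f)
    (hg : LocallyIntegrable g)
    (h : ∀ φ : 𝓢(Plane, ℂ), ∫ x, φ x * f x = ∫ x, φ x * g x) : f =ᵐ[volume] g := by
  apply ae_eq_of_integral_contDiff_smul_eq hf hg
  intro φ hφ hφc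
  have h₁ : HasCompactSupport (Complex.ofRealCLM ∘ φ) := hφc.comp_left rfl
  have h₂ : ContDiff ℝ ((⊤ : ℕ∞) : WithTop ℕ∞) (Complex.ofRealCLM ∘ φ) :=
    Complex.ofRealCLM.contDiff.comp hφ
  simpa using h (h₁.toSchwartzMap h₂)

/-- The Fourier transform on `L²` is given by the Fourier integral on `L¹ ∩ L²`. -/
theorem coeFn_fourier_toLp {a : Plane → ℂ} (h1 : Integrable a) (h2 : MemLp a 2) :
    (𝓕 (h2.toLp a) : Lp ℂ 2 (volume : Measure Plane)) =ᵐ[volume] 𝓕 a := by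
  apply ae_eq_of_integral_schwartz_eq
  · exact (Lp.memLp _).locallyIntegrable (by norm_num)
  · exact (continuous_fourier h1).locallyIntegrable
  · intro G
    have h3 := DFunLike.congr_fun (Lp.fourier_toTemperedDistribution_eq (h2.toLp a)) G
    rw [TemperedDistribution.fourier_apply, Lp.toTemperedDistribution_apply,
      Lp.toTemperedDistribution_apply] at h3
    refine h3.symm.trans ?_
    calc ∫ x, (𝓕 G) x • h2.toLp a x
        = ∫ x, a x * (𝓕 (G : Plane → ℂ)) x := by
          apply integral_congr_ae
          filter_upwards [h2.coeFn_toLp] with x hx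
          rw [hx, SchwartzMap.fourier_coe, smul_eq_mul, mul_comm]
      _ = ∫ x, 𝓕 a x * G x := (integral_fourier_smul_eq h1 G.integrable).symm
      _ = ∫ x, G x * 𝓕 a x := by simp_rw [mul_comm]

/-- **Plancherel's theorem** for integrable square integrable functions. -/
theorem eLpNorm_two_fourier_eq {a : Plane → ℂ} (h1 : Integrable a) (h2 : MemLp a 2) :
    eLpNorm (𝓕 a) 2 = eLpNorm a 2 := by
  rw [← eLpNorm_congr_ae (coeFn_fourier_toLp h1 h2), ← eLpNorm_congr_ae h2.coeFn_toLp,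
    ← Lp.enorm_def, ← Lp.enorm_def, ← ofReal_norm, ← ofReal_norm, Lp.norm_fourier_eq]

/-- An interpolation inequality between `L²` and `L^∞`. -/
theorem eLpNorm_le_interpolate {g : Plane → ℂ} (hg : AEStronglyMeasurable g)
    {M : ℝ≥0∞} (hM : ∀ x, ‖g x‖ₑ ≤ M) {r : ℝ≥0∞} (hr : 2 ≤ r) (hr' : r < ∞) :
    eLpNorm g r ≤ eLpNorm g 2 ^ (2 / r.toReal) * M ^ (1 - 2 / r.toReal) := by
  have hr2 : 2 ≤ r.toReal := by
    rw [← ENNReal.toReal_ofNat]; exact ENNReal.toReal_mono hr'.ne hr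
  have hr0 : r ≠ 0 := (lt_of_lt_of_le (by norm_num) hr).ne'
  rw [eLpNorm_eq_lintegral_rpow_enorm_toReal hr0 hr'.ne,
    eLpNorm_eq_lintegral_rpow_enorm_toReal (by norm_num) (by norm_num), ← ENNReal.rpow_mul]
  have : ∫⁻ x, ‖g x‖ₑ ^ r.toReal ≤ M ^ (r.toReal - 2) * ∫⁻ x, ‖g x‖ₑ ^ (2 : ℝ) := by
    rw [← lintegral_const_mul'' _ (hg.enorm.pow_const _)]
    apply lintegral_mono
    intro x
    calc ‖g x‖ₑ ^ r.toReal = ‖g x‖ₑ ^ (r.toReal - 2) * ‖g x‖ₑ ^ (2 : ℝ) := by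
          rw [← ENNReal.rpow_add_of_nonneg _ _ (by linarith) (by norm_num)]; simp
      _ ≤ _ := mul_le_mul' (ENNReal.rpow_le_rpow (hM x) (by linarith)) le_rfl
  calc _ ≤ (M ^ (r.toReal - 2) * ∫⁻ x, ‖g x‖ₑ ^ (2 : ℝ)) ^ (1 / r.toReal) := by gcongr
    _ = _ := by
      rw [ENNReal.mul_rpow_of_nonneg _ _ (by positivity), ← ENNReal.rpow_mul, mul_comm]
      simp only [ENNReal.toReal_ofNat]
      congr 2
      · field_simp
      · field_simp

/-- Plancherel supplies the $L^2$ endpoint and the trivial sup bound the $L^\infty$ one; this takes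
the place of Hausdorff–Young. -/
theorem eLpNorm_fourier_le {a : Plane → ℂ} (h1 : Integrable a) (h2 : MemLp a 2)
    {r : ℝ≥0∞} (hr : 2 ≤ r) (hr' : r < ∞) :
    eLpNorm (𝓕 a) r ≤ eLpNorm a 2 ^ (2 / r.toReal) * eLpNorm a 1 ^ (1 - 2 / r.toReal) := by
  rw [← eLpNorm_two_fourier_eq h1 h2]
  refine eLpNorm_le_interpolate (continuous_fourier h1).aestronglyMeasurable (fun x => ?_) hr hr'
  rw [eLpNorm_one_eq_lintegral_enorm, ← ofReal_integral_norm_eq_lintegral_enorm h1, ← ofReal_norm]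
  exact ENNReal.ofReal_le_ofReal (norm_fourier_le_integral a x)

theorem two_div_toReal_le_one {r : ℝ≥0∞} (hr : 2 ≤ r) (hr' : r < ∞) : 2 / r.toReal ≤ 1 := by
  have hr2 : 2 ≤ r.toReal := by
    rw [← ENNReal.toReal_ofNat]; exact ENNReal.toReal_mono hr'.ne hr
  rw [div_le_one (by linarith)]; exact hr2

theorem memLp_fourier {a : Plane → ℂ} (h1 : Integrable a) (h2 : MemLp a 2)
    {r : ℝ≥0∞} (hr : 2 ≤ r) (hr' : r < ∞) : MemLp (𝓕 a) r := by
  refine ⟨(continuous_fourier h1).aestronglyMeasurable, (eLpNorm_fourier_le h1 h2 hr hr').trans_lt ?_⟩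
  have := two_div_toReal_le_one hr hr'
  exact ENNReal.mul_lt_top (ENNReal.rpow_lt_top_of_nonneg (by positivity) h2.2.ne)
    (ENNReal.rpow_lt_top_of_nonneg (by linarith) (memLp_one_iff_integrable.2 h1).2.ne)

/-! ### Bounds for the symbol and its dependence on time -/

theorem continuous_viscousSymbol (t : ℝ) : Continuous (viscousSymbol t) := by
  unfold viscousSymbol
  have := Real.continuous_sinc
  fun_prop

theorem abs_viscousSymbol_le {t : ℝ} (ht : 0 ≤ t) (ξ : Plane) :
    |viscousSymbol t ξ| ≤ t * Real.exp (-(Real.pi * t * ‖ξ‖)) := by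
  unfold viscousSymbol
  rw [abs_mul, Real.abs_exp, abs_mul, abs_of_nonneg ht, mul_comm]
  have h : -(2 * Real.pi * ‖ξ‖) / 2 * t = -(Real.pi * t * ‖ξ‖) := by ring
  rw [h]
  gcongr
  exact mul_le_of_le_one_right ht (Real.abs_sinc_le_one _)

theorem hasDerivAt_mul_sinc (b t : ℝ) :
    HasDerivAt (fun t => t * Real.sinc (b * t)) (Real.cos (b * t)) t := by
  rcases eq_or_ne b 0 with rfl | hb
  · simpa using hasDerivAt_id' t
  · have h : (fun t => t * Real.sinc (b * t)) = fun t => Real.sin (b * t) / b := by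
      ext t
      rcases eq_or_ne t 0 with rfl | ht
      · simp
      · rw [Real.sinc_of_ne_zero (mul_ne_zero hb ht)]
        field_simp
    rw [h]
    have := ((hasDerivAt_id t).const_mul b).sin.div_const b
    simpa [hb] using this

/-- The time derivative has two terms, each at most 1: one because $ye^{-y}\le1$, the other because
$|\cos|\le1$. Uniformity in `ξ` later makes the flow Lipschitz in time, hence measurable. -/
theorem abs_viscousSymbol_sub_le {t t' : ℝ} (ht : 0 ≤ t) (ht' : 0 ≤ t') (ξ : Plane) :
    |viscousSymbol t ξ - viscousSymbol t' ξ| ≤ 2 * |t - t'| := by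
  set a := -(2 * Real.pi * ‖ξ‖) / 2 with ha
  set b := Real.sqrt 3 / 2 * (2 * Real.pi * ‖ξ‖) with hb
  have ha0 : a ≤ 0 := by
    have : 0 ≤ Real.pi * ‖ξ‖ := by positivity
    rw [ha]; linarith
  have hd : ∀ x ∈ Set.Ici (0 : ℝ), HasDerivWithinAt (fun t => viscousSymbol t ξ)
      (Real.exp (a * x) * a * (x * Real.sinc (b * x)) + Real.exp (a * x) * Real.cos (b * x))
      (Set.Ici 0) x := by
    intro x _
    have h1 : HasDerivAt (fun t => Real.exp (a * t)) (Real.exp (a * x) * a) x := by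
      simpa using ((hasDerivAt_id x).const_mul a).exp
    exact (h1.mul (hasDerivAt_mul_sinc b x)).hasDerivWithinAt
  refine (convex_Ici (0 : ℝ)).norm_image_sub_le_of_norm_hasDerivWithin_le hd ?_ ht' ht
  intro x hx
  have hx : 0 ≤ x := hx
  refine (norm_add_le _ _).trans ?_
  have h1 : ‖Real.exp (a * x) * Real.cos (b * x)‖ ≤ 1 := by
    rw [norm_mul, Real.norm_eq_abs, Real.norm_eq_abs, Real.abs_exp]
    exact mul_le_one₀ (Real.exp_le_one_iff.2 (mul_nonpos_of_nonpos_of_nonneg ha0 hx)) (abs_nonneg _)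
      (Real.abs_cos_le_one _)
  have h2 : ‖Real.exp (a * x) * a * (x * Real.sinc (b * x))‖ ≤ 1 := by
    have e : Real.exp (a * x) * a * (x * Real.sinc (b * x)) =
      (a * x * Real.exp (a * x)) * Real.sinc (b * x) := by ring
    rw [e, norm_mul]
    refine mul_le_one₀ ?_ (norm_nonneg _) (Real.abs_sinc_le_one _)
    rw [Real.norm_eq_abs, abs_mul, Real.abs_exp,
      abs_of_nonpos (mul_nonpos_of_nonpos_of_nonneg ha0 hx)]
    have h3 : -(a * x) ≤ Real.exp (-(a * x)) := by
      linarith [Real.add_one_le_exp (-(a * x))]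
    calc -(a * x) * Real.exp (a * x) ≤ Real.exp (-(a * x)) * Real.exp (a * x) := by gcongr
      _ = 1 := by rw [← Real.exp_add]; simp
  linarith

/-- The amplitude `m_t θ` of which `viscousTest` takes the Fourier transform. -/
noncomputable def viscousAmplitude (t : ℝ) (θ : Plane → ℂ) : Plane → ℂ :=
  fun ξ => (viscousSymbol t ξ : ℂ) * θ ξ

theorem viscousTest_eq (t : ℝ) (φ : 𝓢(Plane, ℂ)) :
    viscousTest t φ = 𝓕 (viscousAmplitude t (𝓕⁻ φ : 𝓢(Plane, ℂ))) := rfl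

theorem norm_viscousAmplitude_le {t : ℝ} (ht : 0 ≤ t) (θ : Plane → ℂ) (ξ : Plane) :
    ‖viscousAmplitude t θ ξ‖ ≤ t * Real.exp (-(Real.pi * t * ‖ξ‖)) * ‖θ ξ‖ := by
  unfold viscousAmplitude
  rw [norm_mul, Complex.norm_real]
  gcongr
  exact abs_viscousSymbol_le ht ξ

theorem memLp_viscousAmplitude {t : ℝ} (ht : 0 ≤ t) (θ : 𝓢(Plane, ℂ)) {p : ℝ≥0∞} :
    MemLp (viscousAmplitude t θ) p := by
  refine MemLp.of_le_mul (c := t) (θ.memLp p) ?_ (Filter.Eventually.of_forall fun ξ => ?_)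
  · have := continuous_viscousSymbol t
    have := θ.continuous
    unfold viscousAmplitude
    exact Continuous.aestronglyMeasurable (by fun_prop)
  · refine (norm_viscousAmplitude_le ht _ ξ).trans ?_
    gcongr
    refine mul_le_of_le_one_right ht (Real.exp_le_one_iff.2 ?_)
    have : 0 ≤ Real.pi * t * ‖ξ‖ := by positivity
    linarith

theorem integrable_viscousAmplitude {t : ℝ} (ht : 0 ≤ t) (θ : 𝓢(Plane, ℂ)) :
    Integrable (viscousAmplitude t θ) :=
  memLp_one_iff_integrable.1 (memLp_viscousAmplitude ht θ)

theorem eLpNorm_viscousAmplitude_sub_le {t t' : ℝ} (ht : 0 ≤ t) (ht' : 0 ≤ t') (θ : 𝓢(Plane, ℂ))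
    (p : ℝ≥0∞) :
    eLpNorm (viscousAmplitude t θ - viscousAmplitude t' θ) p ≤
      ENNReal.ofReal (2 * |t - t'|) * eLpNorm θ p := by
  refine eLpNorm_le_mul_eLpNorm_of_ae_le_mul (Filter.Eventually.of_forall fun ξ => ?_) p
  have : viscousAmplitude t θ ξ - viscousAmplitude t' θ ξ =
      ((viscousSymbol t ξ - viscousSymbol t' ξ : ℝ) : ℂ) * θ ξ := by
    unfold viscousAmplitude; push_cast; ring
  rw [Pi.sub_apply, this, norm_mul, Complex.norm_real]
  gcongr
  exact abs_viscousSymbol_sub_le ht ht' ξ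

theorem memLp_viscousTest {t : ℝ} (ht : 0 ≤ t) (φ : 𝓢(Plane, ℂ)) {r : ℝ≥0∞} (hr : 2 ≤ r)
    (hr' : r < ∞) : MemLp (viscousTest t φ) r :=
  memLp_fourier (integrable_viscousAmplitude ht _) (memLp_viscousAmplitude ht _) hr hr'

theorem fourier_sub_of_integrable {a b : Plane → ℂ} (ha : Integrable a) (hb : Integrable b) :
    𝓕 (a - b) = 𝓕 a - 𝓕 b := by
  ext ξ
  simp only [Real.fourier_eq, Pi.sub_apply, smul_sub]
  exact integral_sub ((Real.fourierIntegral_convergent_iff ξ).2 ha)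
    ((Real.fourierIntegral_convergent_iff ξ).2 hb)

theorem eLpNorm_viscousTest_sub_le {t t' : ℝ} (ht : 0 ≤ t) (ht' : 0 ≤ t') (φ : 𝓢(Plane, ℂ))
    {r : ℝ≥0∞} (hr : 2 ≤ r) (hr' : r < ∞) :
    eLpNorm (viscousTest t φ - viscousTest t' φ) r ≤ ENNReal.ofReal (2 * |t - t'|) *
      (eLpNorm (𝓕⁻ φ : 𝓢(Plane, ℂ)) 2 ^ (2 / r.toReal) *
        eLpNorm (𝓕⁻ φ : 𝓢(Plane, ℂ)) 1 ^ (1 - 2 / r.toReal)) := by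
  rw [viscousTest_eq, viscousTest_eq, ← fourier_sub_of_integrable (integrable_viscousAmplitude ht _)
    (integrable_viscousAmplitude ht' _)]
  refine (eLpNorm_fourier_le ((integrable_viscousAmplitude ht _).sub
    (integrable_viscousAmplitude ht' _))
    ((memLp_viscousAmplitude ht _).sub (memLp_viscousAmplitude ht' _)) hr hr').trans ?_
  have h0 : 0 ≤ 2 / r.toReal := by positivity
  have h1 : 0 ≤ 1 - 2 / r.toReal := by linarith [two_div_toReal_le_one hr hr']
  refine (mul_le_mul' (ENNReal.rpow_le_rpow (eLpNorm_viscousAmplitude_sub_le ht ht' _ 2) h0)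
    (ENNReal.rpow_le_rpow (eLpNorm_viscousAmplitude_sub_le ht ht' _ 1) h1)).trans_eq ?_
  rw [ENNReal.mul_rpow_of_nonneg _ _ h0, ENNReal.mul_rpow_of_nonneg _ _ h1, mul_mul_mul_comm,
    ← ENNReal.rpow_add_of_nonneg _ _ h0 h1]
  simp

/-! ### The spatial estimate at a fixed time -/

/-- The exchange rate between derivatives and damping: since $\sigma\le1$, $\sigma(1+x)\le1+\sigma
x\le e^{\sigma x}$. -/
theorem one_add_rpow_le {σ x ρ : ℝ} (hσ : 0 < σ) (hσ1 : σ ≤ 1) (hx : 0 ≤ x) (hρ : 0 ≤ ρ)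
    (hρ1 : ρ ≤ 1) : (1 + x) ^ ρ ≤ σ ^ (-ρ) * Real.exp (σ * x) := by
  have h1 : 1 + x ≤ σ⁻¹ * Real.exp (σ * x) := by
    rw [inv_mul_eq_div, le_div_iff₀ hσ]
    nlinarith [Real.add_one_le_exp (σ * x)]
  calc (1 + x) ^ ρ ≤ (σ⁻¹ * Real.exp (σ * x)) ^ ρ := by gcongr
    _ = σ ^ (-ρ) * Real.exp (σ * x) ^ ρ := by
      rw [Real.mul_rpow (by positivity) (by positivity), Real.inv_rpow hσ.le, Real.rpow_neg hσ.le]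
    _ ≤ _ := by
      gcongr
      refine (Real.rpow_le_rpow_of_exponent_le ?_ hρ1).trans_eq (Real.rpow_one _)
      exact Real.one_le_exp (by positivity)

/-- The weighted energy `∫ exp (-π σ ‖ξ‖) (1 + ‖ξ‖) ^ (2 κ) ‖ψ ξ‖ ^ 2`. -/
noncomputable def dampedEnergy (κ : ℝ) (ψ : Plane → ℂ) (σ : ℝ) : ℝ≥0∞ :=
  ∫⁻ ξ, ENNReal.ofReal (Real.exp (-(Real.pi * σ * ‖ξ‖)) * (1 + ‖ξ‖) ^ (2 * κ)) * ‖ψ ξ‖ₑ ^ 2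

/-- The function whose `L²` norm is the square root of `dampedEnergy`. -/
noncomputable def dampedWeight (κ : ℝ) (ψ : Plane → ℂ) (σ : ℝ) (ξ : Plane) : ℝ :=
  Real.exp (-(Real.pi * σ * ‖ξ‖ / 2)) * (1 + ‖ξ‖) ^ κ * ‖ψ ξ‖

theorem eLpNorm_dampedWeight (κ : ℝ) (ψ : Plane → ℂ) (σ : ℝ) :
    eLpNorm (dampedWeight κ ψ σ) 2 = dampedEnergy κ ψ σ ^ (1 / 2 : ℝ) := by
  rw [eLpNorm_eq_lintegral_rpow_enorm_toReal (by norm_num) (by norm_num)]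
  unfold dampedEnergy dampedWeight
  simp only [ENNReal.toReal_ofNat, ENNReal.rpow_ofNat]
  congr 1
  apply lintegral_congr
  intro ξ
  rw [enorm_mul, enorm_norm, mul_pow, Real.enorm_eq_ofReal (by positivity),
    ← ENNReal.ofReal_pow (by positivity), mul_pow, ← Real.exp_nat_mul, ← Real.rpow_mul_natCast
    (by positivity)]
  have e : ((2 : ℕ) : ℝ) * -(Real.pi * σ * ‖ξ‖ / 2) = -(Real.pi * σ * ‖ξ‖) := by
    push_cast; ring
  rw [e, mul_comm κ, Nat.cast_ofNat]

/-- The damping $e^{-\pi\sigma|\xi|}$ is spent three times: $e^{-\sigma|\xi|}$ on the `ρ`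
derivatives, half of the original exponent on the weight, and $e^{-\sigma|\xi|/2}$ is kept for
Cauchy–Schwarz. -/
theorem norm_viscousAmplitude_le_dampedWeight {κ ρ σ : ℝ} (hσ : 0 < σ) (hσ1 : σ ≤ 1)
    (hκ : 0 ≤ κ) (hρ : 0 ≤ ρ) (hρ1 : ρ ≤ 1) {θ ψ : Plane → ℂ}
    (h : ∀ ξ, ‖θ ξ‖ = (1 + ‖ξ‖ ^ 2) ^ ((κ + ρ) / 2) * ‖ψ ξ‖) (ξ : Plane) :
    ‖viscousAmplitude σ θ ξ‖ ≤
      σ ^ (1 - ρ) * (Real.exp (-(σ * ‖ξ‖ / 2)) * dampedWeight κ ψ σ ξ) := by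
  refine (norm_viscousAmplitude_le hσ.le θ ξ).trans ?_
  rw [h]
  unfold dampedWeight
  set x := ‖ξ‖
  have hx : 0 ≤ x := norm_nonneg _
  have h1 : (1 + x ^ 2) ^ ((κ + ρ) / 2) ≤ (1 + x) ^ κ * (1 + x) ^ ρ := by
    rw [← Real.rpow_add (by positivity)]
    calc (1 + x ^ 2) ^ ((κ + ρ) / 2) ≤ ((1 + x) ^ (2 : ℝ)) ^ ((κ + ρ) / 2) := by
          gcongr
          rw [Real.rpow_two]; nlinarith
      _ = _ := by rw [← Real.rpow_mul (by positivity)]; congr 1; ring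
  calc σ * Real.exp (-(Real.pi * σ * x)) * ((1 + x ^ 2) ^ ((κ + ρ) / 2) * ‖ψ ξ‖)
      ≤ σ * Real.exp (-(Real.pi * σ * x)) *
        (((1 + x) ^ κ * (σ ^ (-ρ) * Real.exp (σ * x))) * ‖ψ ξ‖) := by
        gcongr
        refine h1.trans ?_
        gcongr
        exact one_add_rpow_le hσ hσ1 hx hρ hρ1
    _ = σ ^ (1 - ρ) * (Real.exp (-(Real.pi * σ * x) + σ * x) * ((1 + x) ^ κ * ‖ψ ξ‖)) := by
        rw [sub_eq_add_neg, Real.rpow_add hσ, Real.rpow_one, Real.exp_add]; ring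
    _ ≤ σ ^ (1 - ρ) * (Real.exp (-(σ * x / 2) + -(Real.pi * σ * x / 2)) *
          ((1 + x) ^ κ * ‖ψ ξ‖)) := by
        refine mul_le_mul_of_nonneg_left (mul_le_mul_of_nonneg_right (Real.exp_le_exp.2 ?_)
          (by positivity)) (by positivity)
        -- The exponents fit because $1+\frac12+\frac\pi2\le\pi$, that is, $\pi\ge3$.
        have : 0 ≤ σ * x := by positivity
        nlinarith [Real.pi_gt_three]
    _ = _ := by rw [Real.exp_add]; ring

theorem continuous_dampedWeight (κ : ℝ) (ψ : 𝓢(Plane, ℂ)) (σ : ℝ) :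
    Continuous (dampedWeight κ ψ σ) := by
  have := ψ.continuous
  unfold dampedWeight
  have h : Continuous fun ξ : Plane => (1 + ‖ξ‖) ^ κ :=
    Continuous.rpow_const (by fun_prop) fun ξ => Or.inl (by positivity)
  fun_prop

theorem memLp_exp_neg_norm : MemLp (fun ξ : Plane => Real.exp (-(‖ξ‖ / 2))) 2 := by
  have hc : Continuous (fun ξ : Plane => Real.exp (-(‖ξ‖ / 2))) := by fun_prop
  rw [memLp_two_iff_integrable_sq hc.aestronglyMeasurable]
  have h3 : Integrable (fun ξ : Plane => (6 : ℝ) * (1 + ‖ξ‖) ^ (-(3 : ℝ))) := by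
    refine (integrable_one_add_norm ?_).const_mul _
    simp; norm_num
  have h4 : Integrable (fun ξ : Plane => Real.exp 1 * ((6 : ℝ) * (1 + ‖ξ‖) ^ (-(3 : ℝ)))) :=
    h3.const_mul _
  refine h4.mono' (by fun_prop) (Filter.Eventually.of_forall fun ξ => ?_)
  have hx : 0 ≤ ‖ξ‖ := norm_nonneg _
  rw [Real.norm_eq_abs, abs_of_nonneg (by positivity), ← Real.exp_nat_mul]
  -- Shifting the exponent allows $e^y\ge y^3/6$ at $y=1+|\xi|$; the power 3 exceeds the dimension
  -- 2.
  have e : ((2 : ℕ) : ℝ) * (-(‖ξ‖ / 2)) = 1 + -(1 + ‖ξ‖) := by push_cast; ring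
  rw [e, Real.exp_add, Real.rpow_neg (by positivity)]
  gcongr
  rw [Real.exp_neg, ← div_eq_mul_inv, inv_eq_one_div, div_le_div_iff₀ (by positivity) (by positivity)]
  have := Real.pow_div_factorial_le_exp (1 + ‖ξ‖) (by positivity) 3
  simp only [Nat.factorial] at this
  norm_num at this
  have e3 : (1 + ‖ξ‖) ^ (3 : ℝ) = (1 + ‖ξ‖) ^ 3 := by norm_cast
  rw [e3]
  linarith

theorem eLpNorm_exp_neg_mul_norm {σ : ℝ} (hσ : 0 < σ) :
    eLpNorm (fun ξ : Plane => Real.exp (-(σ * ‖ξ‖ / 2))) 2 =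
      ENNReal.ofReal (σ ^ (-1 : ℝ)) * eLpNorm (fun ξ : Plane => Real.exp (-(‖ξ‖ / 2))) 2 := by
  rw [eLpNorm_eq_lintegral_rpow_enorm_toReal (by norm_num) (by norm_num),
    eLpNorm_eq_lintegral_rpow_enorm_toReal (by norm_num) (by norm_num)]
  set f : Plane → ℝ≥0∞ := fun ξ => ‖Real.exp (-(‖ξ‖ / 2))‖ₑ ^ (2 : ℝ≥0∞).toReal with hf
  have hfm : Measurable f := by
    have : Continuous (fun ξ : Plane => Real.exp (-(‖ξ‖ / 2))) := by fun_prop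
    exact this.enorm.measurable.pow_const _
  have h1 : ∀ ξ : Plane, ‖Real.exp (-(σ * ‖ξ‖ / 2))‖ₑ ^ (2 : ℝ≥0∞).toReal = f (σ • ξ) := by
    intro ξ
    simp only [hf, norm_smul, Real.norm_eq_abs, abs_of_pos hσ]
  simp_rw [h1]
  -- Dilation in dimension 2 costs $\sigma^{-2}$, hence $\sigma^{-1}$ after the square root.
  have h2 : ∫⁻ ξ, f (σ • ξ) = ENNReal.ofReal (σ⁻¹ ^ 2) * ∫⁻ ξ, f ξ := by
    rw [← lintegral_map hfm (measurable_const_smul σ), Measure.map_addHaar_smul _ hσ.ne',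
      lintegral_smul_measure]
    simp [abs_of_pos hσ, smul_eq_mul]
  rw [h2, ENNReal.mul_rpow_of_nonneg _ _ (by norm_num)]
  congr 1
  rw [ENNReal.ofReal_rpow_of_nonneg (by positivity) (by norm_num), Real.rpow_neg_one]
  congr 1
  rw [← Real.rpow_natCast, ← Real.rpow_mul (by positivity)]
  norm_num

theorem dampedWeight_nonneg (κ : ℝ) (ψ : Plane → ℂ) (σ : ℝ) (ξ : Plane) :
    0 ≤ dampedWeight κ ψ σ ξ := by
  unfold dampedWeight; positivity

theorem eLpNorm_two_viscousAmplitude_le {κ ρ σ : ℝ} (hσ : 0 < σ) (hσ1 : σ ≤ 1)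
    (hκ : 0 ≤ κ) (hρ : 0 ≤ ρ) (hρ1 : ρ ≤ 1) {θ ψ : 𝓢(Plane, ℂ)}
    (h : ∀ ξ, ‖θ ξ‖ = (1 + ‖ξ‖ ^ 2) ^ ((κ + ρ) / 2) * ‖ψ ξ‖) :
    eLpNorm (viscousAmplitude σ θ) 2 ≤
      ENNReal.ofReal (σ ^ (1 - ρ)) * dampedEnergy κ ψ σ ^ (1 / 2 : ℝ) := by
  rw [← eLpNorm_dampedWeight]
  refine eLpNorm_le_mul_eLpNorm_of_ae_le_mul (Filter.Eventually.of_forall fun ξ => ?_) 2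
  have hw := dampedWeight_nonneg κ ψ σ ξ
  refine (norm_viscousAmplitude_le_dampedWeight hσ hσ1 hκ hρ hρ1 h ξ).trans ?_
  rw [Real.norm_eq_abs, abs_of_nonneg hw]
  refine mul_le_mul_of_nonneg_left ?_ (by positivity)
  refine mul_le_of_le_one_left hw (Real.exp_le_one_iff.2 ?_)
  have : 0 ≤ σ * ‖ξ‖ / 2 := by positivity
  linarith

theorem eLpNorm_one_viscousAmplitude_le {κ ρ σ : ℝ} (hσ : 0 < σ) (hσ1 : σ ≤ 1)
    (hκ : 0 ≤ κ) (hρ : 0 ≤ ρ) (hρ1 : ρ ≤ 1) {θ ψ : 𝓢(Plane, ℂ)}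
    (h : ∀ ξ, ‖θ ξ‖ = (1 + ‖ξ‖ ^ 2) ^ ((κ + ρ) / 2) * ‖ψ ξ‖) :
    eLpNorm (viscousAmplitude σ θ) 1 ≤
      ENNReal.ofReal (σ ^ (1 - ρ)) * (ENNReal.ofReal (σ ^ (-1 : ℝ)) *
        eLpNorm (fun ξ : Plane => Real.exp (-(‖ξ‖ / 2))) 2 *
          dampedEnergy κ ψ σ ^ (1 / 2 : ℝ)) := by
  have hc : Continuous (fun ξ : Plane => Real.exp (-(σ * ‖ξ‖ / 2))) := by fun_prop
  have h3 : eLpNorm ((fun ξ : Plane => Real.exp (-(σ * ‖ξ‖ / 2))) • dampedWeight κ ψ σ) 1 ≤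
      eLpNorm (fun ξ : Plane => Real.exp (-(σ * ‖ξ‖ / 2))) 2 * eLpNorm (dampedWeight κ ψ σ) 2 :=
    eLpNorm_smul_le_mul_eLpNorm (p := 2) (q := 2) (r := 1)
      (continuous_dampedWeight κ ψ σ).aestronglyMeasurable hc.aestronglyMeasurable
  rw [← eLpNorm_dampedWeight, ← eLpNorm_exp_neg_mul_norm hσ]
  refine le_trans ?_ (mul_le_mul' le_rfl h3)
  refine eLpNorm_le_mul_eLpNorm_of_ae_le_mul (Filter.Eventually.of_forall fun ξ => ?_) 1
  refine (norm_viscousAmplitude_le_dampedWeight hσ hσ1 hκ hρ hρ1 h ξ).trans_eq ?_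
  rw [Pi.smul_apply', smul_eq_mul, Real.norm_eq_abs,
    abs_of_nonneg (mul_nonneg (Real.exp_pos _).le (dampedWeight_nonneg κ ψ σ ξ))]

/-- The frequency side of the spatial estimate at a fixed time. -/
theorem eLpNorm_viscousTest_le {κ σ : ℝ} (hσ : 0 < σ) (hσ1 : σ ≤ 1) (hκ : 0 ≤ κ)
    {r : ℝ≥0∞} (hr : 2 ≤ r) (hr' : r < ∞) {χ ψ : 𝓢(Plane, ℂ)}
    (h : ∀ ξ, ‖(𝓕⁻ χ : 𝓢(Plane, ℂ)) ξ‖ =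
      (1 + ‖ξ‖ ^ 2) ^ ((κ + 2 / r.toReal) / 2) * ‖ψ ξ‖) :
    eLpNorm (viscousTest σ χ) r ≤
      eLpNorm (fun ξ : Plane => Real.exp (-(‖ξ‖ / 2))) 2 ^ (1 - 2 / r.toReal) *
        dampedEnergy κ ψ σ ^ (1 / 2 : ℝ) := by
  have hρ1 := two_div_toReal_le_one hr hr'
  have hρ : 0 ≤ 2 / r.toReal := by positivity
  set ρ := 2 / r.toReal
  set θ : 𝓢(Plane, ℂ) := 𝓕⁻ χ
  set E := eLpNorm (fun ξ : Plane => Real.exp (-(‖ξ‖ / 2))) 2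
  set W := dampedEnergy κ ψ σ ^ (1 / 2 : ℝ) with hW
  have h2 := eLpNorm_two_viscousAmplitude_le hσ hσ1 hκ hρ hρ1 h
  have h1 := eLpNorm_one_viscousAmplitude_le hσ hσ1 hκ hρ hρ1 h
  refine (eLpNorm_fourier_le (integrable_viscousAmplitude hσ.le θ)
    (memLp_viscousAmplitude hσ.le θ) hr hr').trans ?_
  have hρ' : 0 ≤ 1 - ρ := by linarith
  refine (mul_le_mul' (ENNReal.rpow_le_rpow h2 hρ) (ENNReal.rpow_le_rpow h1 hρ')).trans_eq ?_
  simp only [ENNReal.mul_rpow_of_nonneg _ _ hρ, ENNReal.mul_rpow_of_nonneg _ _ hρ']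
  have e1 : W = W ^ ρ * W ^ (1 - ρ) := by
    rw [← ENNReal.rpow_add_of_nonneg _ _ hρ hρ']; simp
  -- Scale invariance: the gain $\sigma^{1-\rho}$ cancels the Cauchy–Schwarz loss $\sigma^{-1}$
  -- raised to the power $1-\rho$.
  have e2 : ENNReal.ofReal (σ ^ (1 - ρ)) ^ ρ * (ENNReal.ofReal (σ ^ (1 - ρ)) ^ (1 - ρ) *
      ENNReal.ofReal (σ ^ (-1 : ℝ)) ^ (1 - ρ)) = 1 := by
    rw [ENNReal.ofReal_rpow_of_nonneg (by positivity) hρ,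
      ENNReal.ofReal_rpow_of_nonneg (by positivity) hρ',
      ENNReal.ofReal_rpow_of_nonneg (by positivity) hρ', ← ENNReal.ofReal_mul (by positivity),
      ← ENNReal.ofReal_mul (by positivity), ← Real.rpow_mul hσ.le, ← Real.rpow_mul hσ.le,
      ← Real.rpow_mul hσ.le, ← Real.rpow_add hσ, ← Real.rpow_add hσ]
    have : (1 - ρ) * ρ + ((1 - ρ) * (1 - ρ) + -1 * (1 - ρ)) = 0 := by ring
    rw [this]; simp
  conv_rhs => rw [e1]
  calc _ = (ENNReal.ofReal (σ ^ (1 - ρ)) ^ ρ * (ENNReal.ofReal (σ ^ (1 - ρ)) ^ (1 - ρ) *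
      ENNReal.ofReal (σ ^ (-1 : ℝ)) ^ (1 - ρ))) * (E ^ (1 - ρ) * (W ^ ρ * W ^ (1 - ρ))) := by ring
    _ = _ := by rw [e2, one_mul]

/-! ### Integration of the damped energy in time -/

theorem dampedEnergy_le {κ σ : ℝ} (hσ : 0 < σ) (hσ1 : σ ≤ 1) (hκ : 0 ≤ κ) (hκ1 : 2 * κ ≤ 1)
    (ψ : 𝓢(Plane, ℂ)) :
    dampedEnergy κ ψ σ ≤ ENNReal.ofReal (σ ^ (-(2 * κ))) * eLpNorm ψ 2 ^ 2 := by
  have h2 : eLpNorm ψ 2 ^ 2 = ∫⁻ ξ, ‖ψ ξ‖ₑ ^ 2 := by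
    rw [eLpNorm_eq_lintegral_rpow_enorm_toReal (by norm_num) (by norm_num), ← ENNReal.rpow_mul_natCast]
    simp
  rw [h2, ← lintegral_const_mul' _ _ ENNReal.ofReal_ne_top]
  refine lintegral_mono fun ξ => ?_
  refine mul_le_mul' (ENNReal.ofReal_le_ofReal ?_) le_rfl
  have h := one_add_rpow_le hσ hσ1 (norm_nonneg ξ) (by positivity) hκ1
  calc Real.exp (-(Real.pi * σ * ‖ξ‖)) * (1 + ‖ξ‖) ^ (2 * κ)
      ≤ Real.exp (-(Real.pi * σ * ‖ξ‖)) * (σ ^ (-(2 * κ)) * Real.exp (σ * ‖ξ‖)) := by gcongr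
    _ = σ ^ (-(2 * κ)) * Real.exp (-(Real.pi * σ * ‖ξ‖) + σ * ‖ξ‖) := by
        rw [Real.exp_add]; ring
    _ ≤ σ ^ (-(2 * κ)) * 1 := by
        refine mul_le_mul_of_nonneg_left (Real.exp_le_one_iff.2 ?_) (by positivity)
        have : 0 ≤ σ * ‖ξ‖ := by positivity
        nlinarith [Real.pi_gt_three]
    _ = _ := mul_one _

theorem lintegral_rpow_mul_exp_le {κ x : ℝ} (hκ : 0 < κ) (hx : 0 ≤ x) :
    ∫⁻ σ in Set.Ioc (0 : ℝ) 1, ENNReal.ofReal (σ ^ (2 * κ - 1) *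
      (Real.exp (-(Real.pi * σ * x)) * (1 + x) ^ (2 * κ))) ≤
      ENNReal.ofReal (Real.exp 1 * Real.Gamma (2 * κ)) := by
  have hb : (0 : ℝ) < 1 + x := by positivity
  have hg := Real.integral_rpow_mul_exp_neg_mul_Ioi (a := 2 * κ) (r := 1 + x) (by positivity) hb
  have hint : IntegrableOn (fun σ : ℝ => σ ^ (2 * κ - 1) * Real.exp (-((1 + x) * σ)))
      (Set.Ioi 0) := by
    -- A non-integrable function would have integral 0 by convention, against the positive Gamma
    -- value in `hg`.
    by_contra hc
    rw [integral_undef hc] at hg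
    have : 0 < (1 / (1 + x)) ^ (2 * κ) * Real.Gamma (2 * κ) :=
      mul_pos (by positivity) (Real.Gamma_pos_of_pos (by positivity))
    exact this.ne hg
  have hint2 := hint.const_mul (Real.exp 1 * (1 + x) ^ (2 * κ))
  calc _ ≤ ∫⁻ σ in Set.Ioc (0 : ℝ) 1, ENNReal.ofReal (Real.exp 1 * (1 + x) ^ (2 * κ) *
        (σ ^ (2 * κ - 1) * Real.exp (-((1 + x) * σ)))) := by
        refine setLIntegral_mono' measurableSet_Ioc fun σ hσ => ENNReal.ofReal_le_ofReal ?_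
        have h0 : 0 < σ := hσ.1
        have e : Real.exp (-(Real.pi * σ * x)) ≤ Real.exp 1 * Real.exp (-((1 + x) * σ)) := by
          rw [← Real.exp_add]
          refine Real.exp_le_exp.2 ?_
          have : 0 ≤ σ * x := by positivity
          nlinarith [Real.pi_gt_three, hσ.2]
        calc σ ^ (2 * κ - 1) * (Real.exp (-(Real.pi * σ * x)) * (1 + x) ^ (2 * κ))
            ≤ σ ^ (2 * κ - 1) * ((Real.exp 1 * Real.exp (-((1 + x) * σ))) * (1 + x) ^ (2 * κ)) := by
              gcongr
          _ = _ := by ring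
    _ ≤ ∫⁻ σ in Set.Ioi (0 : ℝ), ENNReal.ofReal (Real.exp 1 * (1 + x) ^ (2 * κ) *
        (σ ^ (2 * κ - 1) * Real.exp (-((1 + x) * σ)))) :=
        lintegral_mono_set Set.Ioc_subset_Ioi_self
    _ = ENNReal.ofReal (∫ σ in Set.Ioi (0 : ℝ), Real.exp 1 * (1 + x) ^ (2 * κ) *
        (σ ^ (2 * κ - 1) * Real.exp (-((1 + x) * σ)))) := by
        refine (ofReal_integral_eq_lintegral_ofReal hint2 ?_).symm
        refine (ae_restrict_iff' measurableSet_Ioi).2 (Filter.Eventually.of_forall fun σ hσ => ?_)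
        have : (0 : ℝ) < σ := hσ
        simp only [Pi.zero_apply]
        positivity
    _ = _ := by
        rw [integral_const_mul, hg, Real.div_rpow zero_le_one hb.le, Real.one_rpow]
        congr 1
        field_simp

/-- By Tonelli the time integral may be done first at each frequency, where it is bounded uniformly
in `ξ`. -/
theorem lintegral_dampedEnergy_le {κ : ℝ} (hκ : 0 < κ) (ψ : 𝓢(Plane, ℂ)) :
    ∫⁻ σ in Set.Ioc (0 : ℝ) 1, ENNReal.ofReal (σ ^ (2 * κ - 1)) * dampedEnergy κ ψ σ ≤
      ENNReal.ofReal (Real.exp 1 * Real.Gamma (2 * κ)) * eLpNorm ψ 2 ^ 2 := by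
  have h2 : eLpNorm ψ 2 ^ 2 = ∫⁻ ξ, ‖ψ ξ‖ₑ ^ 2 := by
    rw [eLpNorm_eq_lintegral_rpow_enorm_toReal (by norm_num) (by norm_num), ← ENNReal.rpow_mul_natCast]
    simp
  have hψ : Measurable ψ := ψ.continuous.measurable
  have hm : Measurable fun z : ℝ × Plane => ENNReal.ofReal (z.1 ^ (2 * κ - 1) *
      (Real.exp (-(Real.pi * z.1 * ‖z.2‖)) * (1 + ‖z.2‖) ^ (2 * κ))) * ‖ψ z.2‖ₑ ^ 2 := by
    fun_prop
  have h3 : ∀ σ ∈ Set.Ioc (0 : ℝ) 1, ENNReal.ofReal (σ ^ (2 * κ - 1)) * dampedEnergy κ ψ σ =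
      ∫⁻ ξ, ENNReal.ofReal (σ ^ (2 * κ - 1) *
      (Real.exp (-(Real.pi * σ * ‖ξ‖)) * (1 + ‖ξ‖) ^ (2 * κ))) * ‖ψ ξ‖ₑ ^ 2 := by
    intro σ hσ
    have : (0 : ℝ) < σ := hσ.1
    unfold dampedEnergy
    rw [← lintegral_const_mul' _ _ ENNReal.ofReal_ne_top]
    refine lintegral_congr fun ξ => ?_
    rw [← mul_assoc, ← ENNReal.ofReal_mul (by positivity)]
  rw [setLIntegral_congr_fun measurableSet_Ioc h3, lintegral_lintegral_swap hm.aemeasurable, h2,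
    ← lintegral_const_mul' _ _ ENNReal.ofReal_ne_top]
  refine lintegral_mono fun ξ => ?_
  simp only
  rw [lintegral_mul_const' _ _ (by simp)]
  exact mul_le_mul' (lintegral_rpow_mul_exp_le hκ (norm_nonneg ξ)) le_rfl

/-- Write $W^{q/2}=W^{(q-2)/2}W$ and use the pointwise bound on the first factor only. The resulting
power $\sigma^{2/q-1}$ is exactly the weight integrated in `lintegral_dampedEnergy_le`. -/
theorem rpow_half_rpow_le {q σ : ℝ} (hq : 2 ≤ q) (hσ : 0 < σ) {W N : ℝ≥0∞}
    (h : W ≤ ENNReal.ofReal (σ ^ (-(2 * (1 / q)))) * N ^ 2) :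
    (W ^ (1 / 2 : ℝ)) ^ q ≤ N ^ (q - 2) * (ENNReal.ofReal (σ ^ (2 * (1 / q) - 1)) * W) := by
  have hq2 : 0 ≤ (q - 2) / 2 := by linarith
  have e0 : (W ^ (1 / 2 : ℝ)) ^ q = W ^ ((q - 2) / 2) * W := by
    have : (1 / 2 : ℝ) * q = (q - 2) / 2 + 1 := by ring
    rw [← ENNReal.rpow_mul, this, ENNReal.rpow_add_of_nonneg _ _ hq2 zero_le_one,
      ENNReal.rpow_one]
  have e1 : -(2 * (1 / q)) * ((q - 2) / 2) = 2 * (1 / q) - 1 := by field_simp; ring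
  have e2 : ((2 : ℕ) : ℝ) * ((q - 2) / 2) = q - 2 := by push_cast; ring
  have e3 : (ENNReal.ofReal (σ ^ (-(2 * (1 / q)))) * N ^ 2) ^ ((q - 2) / 2) =
      ENNReal.ofReal (σ ^ (2 * (1 / q) - 1)) * N ^ (q - 2) := by
    rw [ENNReal.mul_rpow_of_nonneg _ _ hq2, ENNReal.ofReal_rpow_of_nonneg
      (Real.rpow_nonneg hσ.le _) hq2, ← Real.rpow_mul hσ.le, ← ENNReal.rpow_natCast N,
      ← ENNReal.rpow_mul, e1, e2]
  rw [e0]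
  refine (mul_le_mul' (ENNReal.rpow_le_rpow h hq2) le_rfl).trans_eq ?_
  rw [e3]; ring

theorem lintegral_dampedEnergy_rpow_le {q : ℝ} (hq : 2 ≤ q) (ψ : 𝓢(Plane, ℂ)) :
    ∫⁻ σ in Set.Ioc (0 : ℝ) 1, (dampedEnergy (1 / q) ψ σ ^ (1 / 2 : ℝ)) ^ q ≤
      ENNReal.ofReal (Real.exp 1 * Real.Gamma (2 * (1 / q))) * eLpNorm ψ 2 ^ q := by
  have hq0 : 0 < q := by linarith
  have hκ : 0 < 1 / q := by positivity
  have hκ1 : 2 * (1 / q) ≤ 1 := by rw [mul_one_div, div_le_one hq0]; exact hq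
  have hN : eLpNorm ψ 2 ≠ ∞ := (ψ.memLp 2 volume).eLpNorm_ne_top
  have hlast : eLpNorm ψ 2 ^ q = eLpNorm ψ 2 ^ (q - 2) * eLpNorm ψ 2 ^ 2 := by
    have e : q - 2 + 2 = q := by ring
    rw [← ENNReal.rpow_two, ← ENNReal.rpow_add_of_nonneg _ _ (by linarith) (by norm_num), e]
  refine (setLIntegral_mono' measurableSet_Ioc fun σ hσ =>
    rpow_half_rpow_le hq hσ.1 (dampedEnergy_le hσ.1 hσ.2 hκ.le hκ1 ψ)).trans ?_
  rw [lintegral_const_mul' _ _ (ENNReal.rpow_ne_top_of_nonneg (by linarith) hN), hlast,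
    mul_left_comm]
  gcongr
  exact lintegral_dampedEnergy_le hκ ψ

/-! ### The Bessel potential of a Schwartz function -/

/-- The transpose of `besselPotential`, on Schwartz functions. -/
noncomputable def schwartzBessel (s : ℝ) (φ : 𝓢(Plane, ℂ)) : 𝓢(Plane, ℂ) :=
  𝓕 (SchwartzMap.smulLeftCLM ℂ (fun x : Plane => (((1 + ‖x‖ ^ 2) ^ (s / 2) : ℝ) : ℂ)) (𝓕⁻ φ))

theorem besselPotential_apply (s : ℝ) (v : 𝓢'(Plane, ℂ)) (φ : 𝓢(Plane, ℂ)) :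
    besselPotential Plane ℂ s v φ = v (schwartzBessel s φ) := rfl

theorem fourierInv_schwartzBessel_apply (s : ℝ) (φ : 𝓢(Plane, ℂ)) (ξ : Plane) :
    (𝓕⁻ (schwartzBessel s φ) : 𝓢(Plane, ℂ)) ξ =
      (((1 + ‖ξ‖ ^ 2) ^ (s / 2) : ℝ) : ℂ) * (𝓕⁻ φ : 𝓢(Plane, ℂ)) ξ := by
  unfold schwartzBessel
  rw [FourierTransform.fourierInv_fourier_eq, SchwartzMap.smulLeftCLM_apply_apply (by fun_prop),
    smul_eq_mul]

theorem fourierInv_injective {φ χ : 𝓢(Plane, ℂ)}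
    (h : (𝓕⁻ φ : 𝓢(Plane, ℂ)) = 𝓕⁻ χ) : φ = χ := by
  rw [← FourierTransform.fourier_fourierInv_eq (F := 𝓢(Plane, ℂ)) φ, h,
    FourierTransform.fourier_fourierInv_eq]

theorem schwartzBessel_schwartzBessel_neg (s : ℝ) (φ : 𝓢(Plane, ℂ)) :
    schwartzBessel s (schwartzBessel (-s) φ) = φ := by
  apply fourierInv_injective
  ext ξ
  rw [fourierInv_schwartzBessel_apply, fourierInv_schwartzBessel_apply, ← mul_assoc,
    ← Complex.ofReal_mul, ← Real.rpow_add (by positivity)]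
  have : s / 2 + -s / 2 = 0 := by ring
  rw [this]; simp

theorem schwartzBessel_add (s : ℝ) (φ χ : 𝓢(Plane, ℂ)) :
    schwartzBessel s (φ + χ) = schwartzBessel s φ + schwartzBessel s χ := by
  simp [schwartzBessel, FourierTransform.fourierInv_add, FourierTransform.fourier_add]

theorem schwartzBessel_smul (s : ℝ) (c : ℂ) (φ : 𝓢(Plane, ℂ)) :
    schwartzBessel s (c • φ) = c • schwartzBessel s φ := by
  simp [schwartzBessel, FourierTransform.fourierInv_smul, FourierTransform.fourier_smul]

theorem norm_fourierInv_schwartzBessel_apply (s : ℝ) (φ : 𝓢(Plane, ℂ)) (ξ : Plane) :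
    ‖(𝓕⁻ (schwartzBessel s φ) : 𝓢(Plane, ℂ)) ξ‖ =
      (1 + ‖ξ‖ ^ 2) ^ (s / 2) * ‖(𝓕⁻ φ : 𝓢(Plane, ℂ)) ξ‖ := by
  rw [fourierInv_schwartzBessel_apply, norm_mul, Complex.norm_real, Real.norm_eq_abs,
    abs_of_nonneg (by positivity)]

theorem eLpNorm_fourierInv_schwartz (φ : 𝓢(Plane, ℂ)) :
    eLpNorm (𝓕⁻ φ : 𝓢(Plane, ℂ)) 2 = eLpNorm φ 2 := by
  have h : φ.toLp 2 = 𝓕 ((𝓕⁻ φ : 𝓢(Plane, ℂ)).toLp 2) := by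
    rw [SchwartzMap.toLp_fourier_eq, FourierTransform.fourier_fourierInv_eq]
  rw [← eLpNorm_congr_ae (SchwartzMap.coeFn_toLp (𝓕⁻ φ : 𝓢(Plane, ℂ)) 2 volume),
    ← eLpNorm_congr_ae (SchwartzMap.coeFn_toLp φ 2 volume),
    ← Lp.enorm_def, ← Lp.enorm_def, ← ofReal_norm, ← ofReal_norm, h, Lp.norm_fourier_eq]

/-! ### The dual estimate -/

theorem viscousTest_add {t : ℝ} (ht : 0 ≤ t) (φ χ : 𝓢(Plane, ℂ)) :
    viscousTest t (φ + χ) = viscousTest t φ + viscousTest t χ := by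
  ext ξ
  have h : viscousAmplitude t (𝓕⁻ (φ + χ) : 𝓢(Plane, ℂ)) =
      viscousAmplitude t (𝓕⁻ φ : 𝓢(Plane, ℂ)) + viscousAmplitude t (𝓕⁻ χ : 𝓢(Plane, ℂ)) := by
    ext x
    simp [viscousAmplitude, FourierTransform.fourierInv_add, mul_add]
  rw [Pi.add_apply, viscousTest_eq, viscousTest_eq, viscousTest_eq, h]
  simp only [Real.fourier_eq, Pi.add_apply, smul_add]
  exact integral_add ((Real.fourierIntegral_convergent_iff ξ).2 (integrable_viscousAmplitude ht _))
    ((Real.fourierIntegral_convergent_iff ξ).2 (integrable_viscousAmplitude ht _))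

theorem viscousTest_smul (t : ℝ) (c : ℂ) (φ : 𝓢(Plane, ℂ)) :
    viscousTest t (c • φ) = c • viscousTest t φ := by
  ext ξ
  have h : viscousAmplitude t (𝓕⁻ (c • φ) : 𝓢(Plane, ℂ)) =
      c • viscousAmplitude t (𝓕⁻ φ : 𝓢(Plane, ℂ)) := by
    ext x
    simp [viscousAmplitude, FourierTransform.fourierInv_smul, mul_left_comm]
  rw [Pi.smul_apply, viscousTest_eq, viscousTest_eq, h]
  simp only [Real.fourier_eq, Pi.smul_apply, smul_comm _ c]
  exact integral_smul c _

section DualEstimate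

variable {q r : ℝ≥0∞}

/-- `viscousTest |σ| φ` as an element of `L^r`. -/
noncomputable def viscousTestLp (hr : 2 ≤ r) (hr' : r < ∞) (φ : 𝓢(Plane, ℂ)) (σ : ℝ) :
    Lp ℂ r (volume : Measure Plane) :=
  (memLp_viscousTest (abs_nonneg σ) φ hr hr').toLp _

/-- The symbol is Lipschitz in time, and `|σ|` extends this to the whole line. Continuity provides
the strong measurability needed for Bochner spaces in time. -/
theorem continuous_viscousTestLp [Fact (1 ≤ r)] (hr : 2 ≤ r) (hr' : r < ∞) (φ : 𝓢(Plane, ℂ)) :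
    Continuous (viscousTestLp hr hr' φ) := by
  have h0 : 0 ≤ 2 / r.toReal := by positivity
  have h1 : 0 ≤ 1 - 2 / r.toReal := by linarith [two_div_toReal_le_one hr hr']
  set M := eLpNorm (𝓕⁻ φ : 𝓢(Plane, ℂ)) 2 ^ (2 / r.toReal) *
        eLpNorm (𝓕⁻ φ : 𝓢(Plane, ℂ)) 1 ^ (1 - 2 / r.toReal) with hM
  have hMt : M ≠ ∞ := by
    refine ENNReal.mul_ne_top (ENNReal.rpow_ne_top_of_nonneg h0 ?_)
      (ENNReal.rpow_ne_top_of_nonneg h1 ?_)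
    · exact (SchwartzMap.memLp (𝓕⁻ φ : 𝓢(Plane, ℂ)) 2 volume).eLpNorm_ne_top
    · exact (SchwartzMap.memLp (𝓕⁻ φ : 𝓢(Plane, ℂ)) 1 volume).eLpNorm_ne_top
  suffices LipschitzWith (2 * M.toNNReal) (viscousTestLp hr hr' φ) from this.continuous
  intro σ σ'
  unfold viscousTestLp
  rw [Lp.edist_toLp_toLp]
  refine (eLpNorm_viscousTest_sub_le (abs_nonneg σ) (abs_nonneg σ') φ hr hr').trans ?_
  rw [← hM, ENNReal.coe_mul, ENNReal.coe_toNNReal hMt, edist_dist, Real.dist_eq,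
    ENNReal.ofReal_mul (by norm_num), mul_right_comm]
  refine mul_le_mul' (mul_le_mul' (by simp) le_rfl) (ENNReal.ofReal_le_ofReal ?_)
  exact abs_abs_sub_abs_le _ _

theorem enorm_viscousTestLp (hr : 2 ≤ r) (hr' : r < ∞) (φ : 𝓢(Plane, ℂ)) {σ : ℝ} (hσ : 0 ≤ σ) :
    ‖viscousTestLp hr hr' φ σ‖ₑ = eLpNorm (viscousTest σ φ) r := by
  unfold viscousTestLp
  rw [Lp.enorm_toLp, abs_of_nonneg hσ]

theorem coeFn_viscousTestLp (hr : 2 ≤ r) (hr' : r < ∞) (φ : 𝓢(Plane, ℂ)) {σ : ℝ} (hσ : 0 ≤ σ) :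
    viscousTestLp hr hr' φ σ =ᵐ[volume] viscousTest σ φ := by
  have := (memLp_viscousTest (abs_nonneg σ) φ hr hr').coeFn_toLp
  simpa only [viscousTestLp, abs_of_nonneg hσ] using this

theorem viscousTestLp_add (hr : 2 ≤ r) (hr' : r < ∞) (φ χ : 𝓢(Plane, ℂ)) (σ : ℝ) :
    viscousTestLp hr hr' (φ + χ) σ = viscousTestLp hr hr' φ σ + viscousTestLp hr hr' χ σ := by
  unfold viscousTestLp
  rw [← MemLp.toLp_add]
  exact MemLp.toLp_congr _ _ (by rw [viscousTest_add (abs_nonneg σ)])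

theorem viscousTestLp_smul (hr : 2 ≤ r) (hr' : r < ∞) (c : ℂ) (φ : 𝓢(Plane, ℂ)) (σ : ℝ) :
    viscousTestLp hr hr' (c • φ) σ = c • viscousTestLp hr hr' φ σ := by
  unfold viscousTestLp
  rw [← MemLp.toLp_const_smul]
  exact MemLp.toLp_congr _ _ (by rw [viscousTest_smul])

/-- The dual of the Duhamel estimate: the space-time bound for the homogeneous flow. -/
theorem exists_eLpNorm_viscousTestLp_le [Fact (1 ≤ r)] (hq : 2 ≤ q) (hr : 2 ≤ r) (hr' : r < ∞)
    {s : ℝ} (hs : s = 1 / q.toReal + 2 / r.toReal) :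
    ∃ C : ℝ≥0∞, C ≠ ∞ ∧ ∀ φ : 𝓢(Plane, ℂ),
      eLpNorm (viscousTestLp hr hr' (schwartzBessel s φ)) q (volume.restrict (Set.Ioc 0 1)) ≤
        C * eLpNorm φ 2 := by
  set A := eLpNorm (fun ξ : Plane => Real.exp (-(‖ξ‖ / 2))) 2 ^ (1 - 2 / r.toReal) with hA
  have hAt : A ≠ ∞ := ENNReal.rpow_ne_top_of_nonneg
    (by linarith [two_div_toReal_le_one hr hr']) memLp_exp_neg_norm.eLpNorm_ne_top
  have hpt : ∀ φ : 𝓢(Plane, ℂ), ∀ σ ∈ Set.Ioc (0 : ℝ) 1,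
      ‖viscousTestLp hr hr' (schwartzBessel s φ) σ‖ₑ ≤
        A * dampedEnergy (1 / q.toReal) (𝓕⁻ φ : 𝓢(Plane, ℂ)) σ ^ (1 / 2 : ℝ) := by
    intro φ σ hσ
    rw [enorm_viscousTestLp hr hr' _ hσ.1.le]
    refine eLpNorm_viscousTest_le hσ.1 hσ.2 (by positivity) hr hr' fun ξ => ?_
    rw [norm_fourierInv_schwartzBessel_apply, hs]
  rcases eq_or_ne q ∞ with rfl | hqt
  · refine ⟨A, hAt, fun φ => ?_⟩
    rw [eLpNorm_exponent_top]
    refine eLpNormEssSup_le_of_ae_enorm_bound ?_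
    refine (ae_restrict_iff' measurableSet_Ioc).2 (Filter.Eventually.of_forall fun σ hσ => ?_)
    refine (hpt φ σ hσ).trans (mul_le_mul' le_rfl ?_)
    have h := dampedEnergy_le hσ.1 hσ.2 (κ := 0) le_rfl (by norm_num) (𝓕⁻ φ : 𝓢(Plane, ℂ))
    rw [eLpNorm_fourierInv_schwartz] at h
    simp only [mul_zero, neg_zero, Real.rpow_zero, ENNReal.ofReal_one, one_mul] at h
    -- `∞.toReal = 0` and `1 / 0 = 0`, so the convention yields the intended exponent $1/\infty=0$.
    have e : (1 : ℝ) / (∞ : ℝ≥0∞).toReal = 0 := by simp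
    rw [e]
    refine (ENNReal.rpow_le_rpow h (by norm_num)).trans_eq ?_
    rw [← ENNReal.rpow_two, ← ENNReal.rpow_mul]
    norm_num
  · have hq2 : 2 ≤ q.toReal := by
      rw [← ENNReal.toReal_ofNat]; exact ENNReal.toReal_mono hqt hq
    have hq0 : q ≠ 0 := (lt_of_lt_of_le (by norm_num) hq).ne'
    have hqr : 0 < q.toReal := by linarith
    set G := ENNReal.ofReal (Real.exp 1 * Real.Gamma (2 * (1 / q.toReal))) with hG
    refine ⟨A * G ^ (1 / q.toReal), ENNReal.mul_ne_top hAt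
      (ENNReal.rpow_ne_top_of_nonneg (by positivity) ENNReal.ofReal_ne_top), fun φ => ?_⟩
    rw [eLpNorm_eq_lintegral_rpow_enorm_toReal hq0 hqt]
    have h1 := lintegral_dampedEnergy_rpow_le hq2 (𝓕⁻ φ : 𝓢(Plane, ℂ))
    rw [eLpNorm_fourierInv_schwartz, ← hG] at h1
    have h2 : ∫⁻ σ in Set.Ioc (0 : ℝ) 1,
        ‖viscousTestLp hr hr' (schwartzBessel s φ) σ‖ₑ ^ q.toReal ≤
        A ^ q.toReal * (G * eLpNorm φ 2 ^ q.toReal) := by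
      refine le_trans ?_ (mul_le_mul' le_rfl h1)
      rw [← lintegral_const_mul' _ _ (ENNReal.rpow_ne_top_of_nonneg hqr.le hAt)]
      refine setLIntegral_mono' measurableSet_Ioc fun σ hσ => ?_
      rw [← ENNReal.mul_rpow_of_nonneg _ _ hqr.le]
      exact ENNReal.rpow_le_rpow (hpt φ σ hσ) hqr.le
    refine (ENNReal.rpow_le_rpow h2 (by positivity)).trans_eq ?_
    clear_value A
    have h3 : 0 ≤ 1 / q.toReal := by positivity
    rw [ENNReal.mul_rpow_of_nonneg _ _ h3, ENNReal.mul_rpow_of_nonneg _ _ h3, ← ENNReal.rpow_mul,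
      ← ENNReal.rpow_mul, mul_one_div_cancel hqr.ne', ENNReal.rpow_one, ENNReal.rpow_one, mul_assoc]

end DualEstimate

/-! ### Passing from the dual estimate to an operator -/

/-- Functionals on `L²` that depend continuously and linearly on a parameter are represented by
elements of `L²` that depend continuously on it. -/
theorem exists_lp_representation {V : Type*} [NormedAddCommGroup V] [NormedSpace ℂ V]
    (ℓ : V →L[ℂ] Lp ℂ 2 (volume : Measure Plane) →L[ℂ] ℂ) :
    ∃ Φ : V → Lp ℂ 2 (volume : Measure Plane), Continuous Φ ∧ (∀ G, ‖Φ G‖ ≤ ‖ℓ‖ * ‖G‖) ∧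
      ∀ G (φ : 𝓢(Plane, ℂ)), (Φ G : 𝓢'(Plane, ℂ)) φ = ℓ G (φ.toLp 2) := by
  -- Riesz represents by the sesquilinear inner product, whereas distributions pair bilinearly;
  -- conjugation reconciles the two.
  let J : Lp ℂ 2 (volume : Measure Plane) →L[ℝ] Lp ℂ 2 (volume : Measure Plane) :=
    (Complex.conjLIE.toLinearIsometry.toContinuousLinearMap).compLpL 2 volume
  have hJ : ∀ g : Lp ℂ 2 (volume : Measure Plane), ∀ᵐ x, J g x = (starRingEnd ℂ) (g x) := by
    intro g
    exact ContinuousLinearMap.coeFn_compLp _ g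
  have hJn : ∀ g, ‖J g‖ ≤ ‖g‖ := by
    intro g
    refine Lp.norm_le_norm_of_ae_le ?_
    filter_upwards [hJ g] with x hx
    rw [hx, RCLike.norm_conj]
  let D := InnerProductSpace.toDual ℂ (Lp ℂ 2 (volume : Measure Plane))
  refine ⟨fun G => J (D.symm (ℓ G)), J.continuous.comp (D.symm.continuous.comp ℓ.continuous),
    fun G => ?_, fun G φ => ?_⟩
  · refine (hJn _).trans ?_
    rw [LinearIsometryEquiv.norm_map]
    exact ℓ.le_opNorm G
  · have h1 : ℓ G (φ.toLp 2) = inner ℂ (D.symm (ℓ G)) (φ.toLp 2) :=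
      InnerProductSpace.toDual_symm_apply.symm
    rw [h1, Lp.toTemperedDistribution_apply, L2.inner_def]
    apply integral_congr_ae
    filter_upwards [hJ (D.symm (ℓ G)), φ.coeFn_toLp 2 volume] with x hx hφ
    rw [hx, hφ]
    exact (RCLike.inner_apply _ _).symm

section

variable {q r q' r' : ℝ≥0∞}

theorem memLp_indicator_viscousTestLp [Fact (1 ≤ r)] (hr : 2 ≤ r) (hrt : r < ∞)
    {s : ℝ} {C : ℝ≥0∞} (hC : C ≠ ∞)
    (h : ∀ φ : 𝓢(Plane, ℂ), eLpNorm (viscousTestLp hr hrt (schwartzBessel s φ)) q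
      (volume.restrict (Set.Ioc 0 1)) ≤ C * eLpNorm φ 2) (φ : 𝓢(Plane, ℂ)) :
    MemLp ((Set.Ioc (0 : ℝ) 1).indicator (viscousTestLp hr hrt (schwartzBessel s φ))) q := by
  rw [memLp_indicator_iff_restrict measurableSet_Ioc]
  exact ⟨(continuous_viscousTestLp hr hrt _).aestronglyMeasurable, (h φ).trans_lt
    (ENNReal.mul_lt_top hC.lt_top (φ.memLp 2 volume).eLpNorm_lt_top)⟩

theorem MeasureTheory.MemLp.toLp_eq_smul {E : Type*} [NormedAddCommGroup E] [NormedSpace ℂ E]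
    {p : ℝ≥0∞} {f g : ℝ → E} (hf : MemLp f p volume) (hg : MemLp g p volume) (c : ℂ)
    (h : f = c • g) : hf.toLp f = c • hg.toLp g := by
  subst h; rfl

theorem MeasureTheory.MemLp.toLp_eq_add {E : Type*} [NormedAddCommGroup E]
    {p : ℝ≥0∞} {f g k : ℝ → E} (hf : MemLp f p volume) (hg : MemLp g p volume)
    (hk : MemLp k p volume) (h : f = g + k) : hf.toLp f = hg.toLp g + hk.toLp k := by
  subst h; rfl

theorem indicator_viscousTestLp_add (hr : 2 ≤ r) (hrt : r < ∞) (s : ℝ) (φ χ : 𝓢(Plane, ℂ)) :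
    (Set.Ioc (0 : ℝ) 1).indicator (viscousTestLp hr hrt (schwartzBessel s (φ + χ))) =
      (Set.Ioc (0 : ℝ) 1).indicator (viscousTestLp hr hrt (schwartzBessel s φ)) +
        (Set.Ioc (0 : ℝ) 1).indicator (viscousTestLp hr hrt (schwartzBessel s χ)) := by
  rw [← Set.indicator_add']
  congr 1
  ext1 τ
  rw [Pi.add_apply, schwartzBessel_add, viscousTestLp_add]

theorem indicator_viscousTestLp_smul (hr : 2 ≤ r) (hrt : r < ∞) (s : ℝ) (c : ℂ)
    (φ : 𝓢(Plane, ℂ)) :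
    (Set.Ioc (0 : ℝ) 1).indicator (viscousTestLp hr hrt (schwartzBessel s (c • φ))) =
      c • (Set.Ioc (0 : ℝ) 1).indicator (viscousTestLp hr hrt (schwartzBessel s φ)) := by
  ext1 τ
  rw [Pi.smul_apply, schwartzBessel_smul]
  by_cases h : τ ∈ Set.Ioc (0 : ℝ) 1
  · rw [Set.indicator_of_mem h, Set.indicator_of_mem h, viscousTestLp_smul]
  · rw [Set.indicator_of_notMem h, Set.indicator_of_notMem h, smul_zero]

/-- The dual estimate extends by density of Schwartz functions in $L^2$. The explicit formula is
needed only on Schwartz functions, as the result is read as a distribution. -/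
theorem exists_viscousTest_extension [Fact (1 ≤ r)] [Fact (1 ≤ q)] (hq : 2 ≤ q) (hr : 2 ≤ r)
    (hrt : r < ∞) {s : ℝ} (hs : s = 1 / q.toReal + 2 / r.toReal) :
    ∃ K : Lp ℂ 2 (volume : Measure Plane) →L[ℂ]
        Lp (Lp ℂ r (volume : Measure Plane)) q (volume : Measure ℝ),
      ∀ φ : 𝓢(Plane, ℂ), K (φ.toLp 2) =ᵐ[volume]
        (Set.Ioc (0 : ℝ) 1).indicator (viscousTestLp hr hrt (schwartzBessel s φ)) := by
  obtain ⟨C, hC, h⟩ := exists_eLpNorm_viscousTestLp_le hq hr hrt hs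
  have hm := memLp_indicator_viscousTestLp hr hrt hC h
  let K₀ : 𝓢(Plane, ℂ) →ₗ[ℂ] Lp (Lp ℂ r (volume : Measure Plane)) q (volume : Measure ℝ) :=
    { toFun := fun φ => (hm φ).toLp _
      map_add' := fun φ χ =>
        MemLp.toLp_eq_add _ _ _ (indicator_viscousTestLp_add hr hrt s φ χ)
      map_smul' := fun c φ =>
        MemLp.toLp_eq_smul _ _ c (indicator_viscousTestLp_smul hr hrt s c φ) }
  let e : 𝓢(Plane, ℂ) →ₗ[ℂ] Lp ℂ 2 (volume : Measure Plane) :=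
    (SchwartzMap.toLpCLM ℂ ℂ 2 volume).toLinearMap
  have hd : DenseRange e := SchwartzMap.denseRange_toLpCLM ENNReal.ofNat_ne_top
  have hb : ∀ φ, ‖K₀ φ‖ ≤ C.toReal * ‖e φ‖ := by
    intro φ
    have h1 : ‖K₀ φ‖ = (eLpNorm ((Set.Ioc (0 : ℝ) 1).indicator
      (viscousTestLp hr hrt (schwartzBessel s φ))) q volume).toReal := Lp.norm_toLp _ (hm φ)
    have h2 : ‖e φ‖ = (eLpNorm φ 2).toReal := SchwartzMap.norm_toLp
    rw [h1, h2, eLpNorm_indicator_eq_eLpNorm_restrict measurableSet_Ioc, ← ENNReal.toReal_mul]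
    exact ENNReal.toReal_mono (ENNReal.mul_ne_top hC (φ.memLp 2 volume).eLpNorm_ne_top) (h φ)
  refine ⟨K₀.extendOfNorm e, fun φ => ?_⟩
  have h3 : K₀.extendOfNorm e (φ.toLp 2) = K₀ φ := LinearMap.extendOfNorm_eq hd ⟨_, hb⟩ φ
  rw [h3]
  exact (hm φ).coeFn_toLp

theorem exists_pairing_viscousTestLp [Fact (1 ≤ r)] [Fact (1 ≤ r')]
    [ENNReal.HolderConjugate r r'] (hr : 2 ≤ r) (hrt : r < ∞) :
    ∃ B : Lp ℂ r (volume : Measure Plane) →L[ℂ] Lp ℂ r' (volume : Measure Plane) →L[ℂ] ℂ,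
      ∀ (χ : 𝓢(Plane, ℂ)) (σ : ℝ) (_ : 0 ≤ σ) (f : Lp ℂ r' (volume : Measure Plane)),
        B (viscousTestLp hr hrt χ σ) f = ∫ x, viscousTest σ χ x * f x := by
  refine ⟨(ContinuousLinearMap.mul ℂ ℂ).lpPairing volume r r', fun χ σ hσ f => ?_⟩
  rw [ContinuousLinearMap.lpPairing_eq_integral]
  apply integral_congr_ae
  filter_upwards [coeFn_viscousTestLp hr hrt χ hσ] with x hx
  rw [hx, ContinuousLinearMap.mul_apply']

/-- Hölder places the pointwise pairing in $L^1$; this is where absolute convergence of the time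
integral comes from. -/
theorem lpPairing_eq_setIntegral {E F : Type*} [NormedAddCommGroup E] [NormedSpace ℂ E]
    [NormedAddCommGroup F] [NormedSpace ℂ F] [Fact (1 ≤ q)] [Fact (1 ≤ q')]
    [ENNReal.HolderConjugate q q'] (B : E →L[ℂ] F →L[ℂ] ℂ) (f : Lp E q (volume : Measure ℝ))
    (g : Lp F q' (volume : Measure ℝ)) {S : Set ℝ} (hS : MeasurableSet S) {u : ℝ → E}
    (hu : f =ᵐ[volume] S.indicator u) {k : ℝ → ℂ} (hk : ∀ σ ∈ S, B (u σ) (g σ) = k σ) :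
    IntegrableOn k S ∧ B.lpPairing volume q q' f g = ∫ σ in S, k σ := by
  have h : (fun σ => B (f σ) (g σ)) =ᵐ[volume] S.indicator k := by
    filter_upwards [hu] with σ hσ
    rw [hσ]
    by_cases hσS : σ ∈ S
    · simp [hσS, hk σ hσS]
    · simp [hσS]
  constructor
  · rw [← integrable_indicator_iff hS]
    exact ((L1.integrable_coeFn (B.holder 1 f g)).congr (B.coeFn_holder f g)).congr h
  · rw [B.lpPairing_eq_integral, integral_congr_ae h, integral_indicator hS]

set_option maxHeartbeats 1000000 in
/-- The operator `G ↦ (1 - Δ) ^ (s / 2) ∫_0^1 m_σ(D) G(σ) dσ`, defined by duality. -/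
theorem exists_duhamel_operator [Fact (1 ≤ r)] [Fact (1 ≤ q)] [Fact (1 ≤ r')] [Fact (1 ≤ q')]
    [ENNReal.HolderConjugate q q'] [ENNReal.HolderConjugate r r'] (hq : 2 ≤ q) (hr : 2 ≤ r)
    (hrt : r < ∞) {s : ℝ} (hs : s = 1 / q.toReal + 2 / r.toReal) :
    ∃ (C : ℝ) (Φ : Lp (Lp ℂ r' (volume : Measure Plane)) q' (volume : Measure ℝ) →
        Lp ℂ 2 (volume : Measure Plane)), Continuous Φ ∧ (∀ G, ‖Φ G‖ ≤ C * ‖G‖) ∧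
      ∀ (G : Lp (Lp ℂ r' (volume : Measure Plane)) q' (volume : Measure ℝ)) (φ : 𝓢(Plane, ℂ)),
        IntegrableOn (fun σ => ∫ x, viscousTest σ (schwartzBessel s φ) x * G σ x)
          (Set.Ioc (0 : ℝ) 1) ∧
        (Φ G : 𝓢'(Plane, ℂ)) φ = ∫ σ in Set.Ioc (0 : ℝ) 1,
          ∫ x, viscousTest σ (schwartzBessel s φ) x * G σ x := by
  obtain ⟨K, hK⟩ := exists_viscousTest_extension hq hr hrt hs
  obtain ⟨B₁, hB₁⟩ := exists_pairing_viscousTestLp (r' := r') hr hrt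
  obtain ⟨Φ, hΦ, hΦn, hΦe⟩ :=
    -- Flipping makes the source `G` the parameter and leaves a functional on $L^2$ to represent.
    exists_lp_representation (((B₁.lpPairing (volume : Measure ℝ) q q').comp K).flip)
  refine ⟨_, Φ, hΦ, hΦn, fun G φ => ?_⟩
  have h0 : ∀ σ ∈ Set.Ioc (0 : ℝ) 1, B₁ (viscousTestLp hr hrt (schwartzBessel s φ) σ) (G σ) =
      ∫ x, viscousTest σ (schwartzBessel s φ) x * G σ x :=
    fun σ hσ => hB₁ (schwartzBessel s φ) σ hσ.1.le (G σ)
  have h1 := lpPairing_eq_setIntegral B₁ (K (φ.toLp 2)) G measurableSet_Ioc (hK φ) h0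
  have h2 := hΦe G φ
  refine ⟨h1.1, ?_⟩
  refine Eq.trans h2 ?_
  exact h1.2

end

/-! ### The Duhamel integral -/

namespace SobolevH

variable {s : ℝ}

theorem memSobolev_besselPotential_neg (s : ℝ) (g : Lp ℂ 2 (volume : Measure Plane)) :
    MemSobolev s 2 (besselPotential Plane ℂ (-s) (g : 𝓢'(Plane, ℂ))) :=
  ⟨g, by simp⟩

/-- The element of `H^s` with a given image under `toL2`. -/
noncomputable def ofL2 (s : ℝ) (g : Lp ℂ 2 (volume : Measure Plane)) : SobolevH s :=
  ⟨besselPotential Plane ℂ (-s) (g : 𝓢'(Plane, ℂ)), memSobolev_besselPotential_neg s g⟩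

theorem toDistribution_ofL2 (g : Lp ℂ 2 (volume : Measure Plane)) :
    toDistribution s (ofL2 s g) = besselPotential Plane ℂ (-s) (g : 𝓢'(Plane, ℂ)) := rfl

theorem toL2_ofL2 (g : Lp ℂ 2 (volume : Measure Plane)) : toL2 (ofL2 s g) = g := by
  apply lp_ext
  rw [← toL2_spec, toDistribution_ofL2]
  simp

theorem norm_ofL2 (g : Lp ℂ 2 (volume : Measure Plane)) : ‖ofL2 s g‖ = ‖g‖ := by
  rw [norm_eq, toL2_ofL2]

theorem isometry_ofL2 : Isometry (ofL2 s) := by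
  refine Isometry.of_dist_eq fun f g => ?_
  rw [dist_eq_norm, dist_eq_norm, norm_eq]
  have : toL2 (ofL2 s f - ofL2 s g) = toL2 (ofL2 s f) - toL2 (ofL2 s g) :=
    (toL2Hom s).map_sub _ _
  rw [this, toL2_ofL2, toL2_ofL2]

end SobolevH

section

variable {E : Type*} [NormedAddCommGroup E] {p : ℝ≥0∞}

/-- `σ ↦ G (t - σ)` in `L^p`. -/
noncomputable def reflectTranslate (G : Lp E p (volume : Measure ℝ)) (t : ℝ) :
    Lp E p (volume : Measure ℝ) :=
  Lp.compMeasurePreserving (fun σ => t - σ) (Measure.measurePreserving_sub_left volume t) G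

theorem coeFn_reflectTranslate (G : Lp E p (volume : Measure ℝ)) (t : ℝ) :
    reflectTranslate G t =ᵐ[volume] fun σ => G (t - σ) :=
  Lp.coeFn_compMeasurePreserving G _

theorem norm_reflectTranslate [Fact (1 ≤ p)] (G : Lp E p (volume : Measure ℝ)) (t : ℝ) :
    ‖reflectTranslate G t‖ = ‖G‖ :=
  Lp.norm_compMeasurePreserving G _

theorem continuous_reflectTranslate [Fact (1 ≤ p)] (hp : p ≠ ∞)
    (G : Lp E p (volume : Measure ℝ)) : Continuous (reflectTranslate G) := by
  let g : C(ℝ, C(ℝ, ℝ)) := (ContinuousMap.mk (fun a : ℝ × ℝ => a.1 - a.2) (by fun_prop)).curry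
  exact (continuous_const (y := G)).compMeasurePreservingLp g.continuous
    (fun t => Measure.measurePreserving_sub_left volume t) hp

end

section

variable {r r' : ℝ≥0∞} {s : ℝ}

theorem integrable_viscousTest_mul [ENNReal.HolderConjugate r r'] (hr : 2 ≤ r) (hrt : r < ∞)
    {t : ℝ} (ht : 0 ≤ t) (φ : 𝓢(Plane, ℂ)) (f : Lp ℂ r' (volume : Measure Plane)) :
    Integrable (fun x => viscousTest t φ x * f x) :=
  (memLp_viscousTest ht φ hr hrt).integrable_mul (Lp.memLp f)

/-- The substitution `σ = t - τ` in the Duhamel integral. -/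
theorem duhamel_substitution {T t : ℝ} (ht : 0 ≤ t) (htT : t ≤ T) (hT : T ≤ 1)
    {F G : ℝ → Lp ℂ r' (volume : Measure Plane)}
    (hG : G =ᵐ[volume] fun σ => (Set.Icc 0 T).indicator F (t - σ)) (χ : 𝓢(Plane, ℂ))
    (hint : IntegrableOn (fun σ => ∫ x, viscousTest σ χ x * G σ x) (Set.Ioc (0 : ℝ) 1)) :
    IntervalIntegrable (fun τ => ∫ x, viscousTest (t - τ) χ x * F τ x) volume 0 t ∧
      ∫ σ in Set.Ioc (0 : ℝ) 1, ∫ x, viscousTest σ χ x * G σ x =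
        ∫ τ in (0 : ℝ)..t, ∫ x, viscousTest (t - τ) χ x * F τ x := by
  set k : ℝ → ℂ := fun τ => ∫ x, viscousTest (t - τ) χ x * F τ x with hk
  have h1 : ∀ᵐ σ : ℝ, (∫ x, viscousTest σ χ x * G σ x) =
      (Set.Icc (t - T) t).indicator (fun σ => k (t - σ)) σ := by
    filter_upwards [hG] with σ hσ
    rw [hσ]
    by_cases h : σ ∈ Set.Icc (t - T) t
    · have h' : t - σ ∈ Set.Icc 0 T := ⟨by linarith [h.2], by linarith [h.1]⟩
      rw [Set.indicator_of_mem h, Set.indicator_of_mem h', hk]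
      simp only [sub_sub_cancel]
    · have h' : t - σ ∉ Set.Icc 0 T := fun h' => h ⟨by linarith [h'.2], by linarith [h'.1]⟩
      rw [Set.indicator_of_notMem h, Set.indicator_of_notMem h']
      refine integral_eq_zero_of_ae ?_
      filter_upwards [Lp.coeFn_zero ℂ r' (volume : Measure Plane)] with x hx
      rw [hx]; simp
  -- Causality: values of `F` after time `t` sit at `σ < 0`, so the fixed interval `(0, 1]` serves
  -- every `t ≤ T ≤ 1`.
  have hset : Set.Ioc (0 : ℝ) 1 ∩ Set.Icc (t - T) t = Set.Ioc 0 t := by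
    ext σ
    simp only [Set.mem_inter_iff, Set.mem_Ioc, Set.mem_Icc]
    constructor
    · rintro ⟨⟨a, _⟩, _, b⟩; exact ⟨a, b⟩
    · rintro ⟨a, b⟩; exact ⟨⟨a, by linarith⟩, by linarith, b⟩
  have h2 : (fun σ => ∫ x, viscousTest σ χ x * G σ x) =ᵐ[volume.restrict (Set.Ioc (0 : ℝ) 1)]
      (Set.Icc (t - T) t).indicator (fun σ => k (t - σ)) := ae_restrict_of_ae h1
  have h3 : IntervalIntegrable (fun σ => k (t - σ)) volume 0 t := by
    rw [intervalIntegrable_iff_integrableOn_Ioc_of_le ht, ← hset, Set.inter_comm,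
      ← integrableOn_indicator_iff measurableSet_Icc]
    exact hint.congr h2
  constructor
  · have := h3.comp_sub_left t
    simp only [sub_sub_cancel, sub_zero, sub_self] at this
    exact this.symm
  · rw [integral_congr_ae h2, setIntegral_indicator measurableSet_Icc, hset,
      ← intervalIntegral.integral_of_le ht, intervalIntegral.integral_comp_sub_left]
    simp

theorem isViscousDuhamel_ofL2 [ENNReal.HolderConjugate r r'] (hr : 2 ≤ r) (hrt : r < ∞)
    {T t : ℝ} (ht : 0 ≤ t) (htT : t ≤ T) (hT : T ≤ 1)
    {F G : ℝ → Lp ℂ r' (volume : Measure Plane)}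
    (hG : G =ᵐ[volume] fun σ => (Set.Icc 0 T).indicator F (t - σ))
    {g : Lp ℂ 2 (volume : Measure Plane)}
    (h : ∀ φ : 𝓢(Plane, ℂ),
        IntegrableOn (fun σ => ∫ x, viscousTest σ (schwartzBessel s φ) x * G σ x)
          (Set.Ioc (0 : ℝ) 1) ∧
        (g : 𝓢'(Plane, ℂ)) φ = ∫ σ in Set.Ioc (0 : ℝ) 1,
          ∫ x, viscousTest σ (schwartzBessel s φ) x * G σ x) :
    IsViscousDuhamel F t (SobolevH.toDistribution s (SobolevH.ofL2 s g)) := by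
  have h' : ∀ φ : 𝓢(Plane, ℂ),
      IntegrableOn (fun σ => ∫ x, viscousTest σ φ x * G σ x) (Set.Ioc (0 : ℝ) 1) ∧
      (g : 𝓢'(Plane, ℂ)) (schwartzBessel (-s) φ) = ∫ σ in Set.Ioc (0 : ℝ) 1,
          ∫ x, viscousTest σ φ x * G σ x := by
    intro φ
    -- Testing against $(1-\Delta)^{-s/2}\varphi$ removes the Bessel factor built into the operator.
    have := h (schwartzBessel (-s) φ)
    rwa [schwartzBessel_schwartzBessel_neg] at this
  refine ⟨fun φ τ hτ => ?_, fun φ => ?_, fun φ => ?_⟩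
  · exact integrable_viscousTest_mul hr hrt (by linarith [hτ.2]) φ (F τ)
  · exact (duhamel_substitution ht htT hT hG φ (h' φ).1).1
  · rw [SobolevH.toDistribution_ofL2, besselPotential_apply, (h' φ).2]
    exact (duhamel_substitution ht htT hT hG φ (h' φ).1).2

end

/-! ### The gap condition and the conclusion -/

theorem eq_add_of_gap_condition {q r q' r' : ℝ≥0∞} [ENNReal.HolderConjugate q q']
    [ENNReal.HolderConjugate r r'] {s : ℝ}
    (hgap : (2 : ℝ) / 2 - s = 1 / q'.toReal + 2 / r'.toReal - 2) :
    s = 1 / q.toReal + 2 / r.toReal := by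
  have key : ∀ a b : ℝ≥0∞, ENNReal.HolderConjugate a b → 1 / a.toReal + 1 / b.toReal = 1 := by
    intro a b hab
    have h := ENNReal.HolderConjugate.inv_add_inv_eq_one a b
    have ha : a⁻¹ ≠ ∞ := fun h' => by simp [h'] at h
    have hb : b⁻¹ ≠ ∞ := fun h' => by simp [h'] at h
    have := congrArg ENNReal.toReal h
    rw [ENNReal.toReal_add ha hb, ENNReal.toReal_inv, ENNReal.toReal_inv] at this
    simpa using this
  have h1 := key q q' inferInstance
  have h2 := key r r' inferInstance
  have e1 : 2 / r'.toReal = 2 * (1 / r'.toReal) := by ring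
  have e2 : 2 / r.toReal = 2 * (1 / r.toReal) := by ring
  rw [e1] at hgap
  rw [e2]
  linarith

theorem mainTheorem8 (q r q' r' : ℝ≥0∞) [ENNReal.HolderConjugate q q']
    [ENNReal.HolderConjugate r r'] [Fact (1 ≤ r')] (hq : 2 ≤ q) (hr : 2 ≤ r) (hr_top : r < ∞)
    (s : ℝ) (hs : 0 ≤ s)
    (hgap : (2 : ℝ) / 2 - s = 1 / q'.toReal + 2 / r'.toReal - 2) :
    ∃ C : ℝ, 0 < C ∧ ∀ T : ℝ, 0 < T → T ≤ 1 →
      ∀ F : ℝ → Lp ℂ r' (volume : Measure Plane),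
        MemLp F q' (volume.restrict (Set.Icc 0 T)) →
        ∃ u : C(Set.Icc (0 : ℝ) T, SobolevH s),
          (∀ t : Set.Icc (0 : ℝ) T,
            IsViscousDuhamel F (t : ℝ) (SobolevH.toDistribution s (u t))) ∧
          ‖u‖ ≤ C * (eLpNorm F q' (volume.restrict (Set.Icc 0 T))).toReal := by
  have hs' : s = 1 / q.toReal + 2 / r.toReal := eq_add_of_gap_condition (q' := q') (r' := r') hgap
  have : Fact (1 ≤ r) := ⟨le_trans (by norm_num) hr⟩
  have : Fact (1 ≤ q) := ⟨le_trans (by norm_num) hq⟩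
  have : Fact (1 ≤ q') := ⟨ENNReal.HolderConjugate.one_le q' q⟩
  have hq' : q' ≠ ∞ := by
    rintro rfl
    have h := ENNReal.HolderConjugate.inv_add_inv_eq_one q ∞
    rw [ENNReal.inv_top, add_zero, ENNReal.inv_eq_one] at h
    rw [h] at hq
    exact absurd hq (by norm_num)
  obtain ⟨C, Φ, hΦ, hΦn, hΦe⟩ := exists_duhamel_operator (q' := q') (r' := r') hq hr hr_top hs'
  -- The operator bound `C` carries no sign; the maximum with 1 makes the constant positive.
  refine ⟨max C 1, by positivity, fun T hT hT1 F hF => ?_⟩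
  have hFi : MemLp ((Set.Icc 0 T).indicator F) q' volume :=
    (memLp_indicator_iff_restrict measurableSet_Icc).2 hF
  set H := hFi.toLp with hH
  have hHn : ‖H‖ = (eLpNorm F q' (volume.restrict (Set.Icc 0 T))).toReal := by
    rw [hH, Lp.norm_toLp, eLpNorm_indicator_eq_eLpNorm_restrict measurableSet_Icc]
  have hcoe : ∀ t : ℝ, reflectTranslate H t =ᵐ[volume]
      fun σ => (Set.Icc 0 T).indicator F (t - σ) := fun t =>
    (coeFn_reflectTranslate H t).trans
      ((Measure.measurePreserving_sub_left volume t).quasiMeasurePreserving.ae_eq_comp hFi.coeFn_toLp)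
  let u : C(Set.Icc (0 : ℝ) T, SobolevH s) :=
    ⟨fun t => SobolevH.ofL2 s (Φ (reflectTranslate H (t : ℝ))),
      SobolevH.isometry_ofL2.continuous.comp (hΦ.comp
        ((continuous_reflectTranslate hq' H).comp continuous_subtype_val))⟩
  refine ⟨u, fun t => ?_, ?_⟩
  · exact isViscousDuhamel_ofL2 hr hr_top t.2.1 t.2.2 hT1 (hcoe t) (hΦe _)
  · rw [ContinuousMap.norm_le _ (by positivity), ← hHn]
    intro t
    have h1 : ‖u t‖ = ‖Φ (reflectTranslate H (t : ℝ))‖ := SobolevH.norm_ofL2 _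
    rw [h1]
    refine (hΦn _).trans ?_
    rw [norm_reflectTranslate]
    gcongr
    exact le_max_left _ _
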